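/- For a natural number $n\ge 1$ and real $\alpha,\beta>-1$ let $$P_n^{(\alpha,\beta)}(x)=\frac{(\alpha+1)_n}{n!}\sum_{k=0}^{n}\frac{(-n)_k\,(n+\alpha+\beta+1)_k}{k!\,(\alpha+1)_k}\left(\frac{1-x}{2}\right)^k$$ be the Jacobi polynomial, where $(a)_k=a(a+1)\cdots(a+k-1)$, and let $$\phi_n^{(\alpha,\beta)}(\mu)=\sum_{k=0}^{\lfloor n/2\rfloor}\left.\frac{d^{2k}}{dx^{2k}}P_n^{(\alpha,\beta)}(x)\right|_{x=1}\mu^k .$$ Two nonzero real polynomials $g,h$ are said to interlace if all their zeros are real and simple, they have no common zero, between each two consecutive zeros of $g$ there is exactly one zero of $h$, and between each two consecutive zeros of $h$ there is exactly one zero of $g$. Let $n\ge 5$. If $-1<\alpha<0<\beta$, then $\phi_n^{(\alpha+1,\beta+1)}$ interlaces $\phi_{n-2}^{(\alpha+1,\beta+1)}$, and $\phi_n^{(\alpha,\beta)}$ interlaces $\phi_{n-2}^{(\alpha,\beta)}$. Consequently, the polynomials $\phi_n^{(\alpha,\beta)}$ and $\phi_{n-2}^{(\alpha,\beta)}$ interlace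 whenever $-1<\alpha<0<\beta$ or $0<\alpha<1<\beta$. -/

import Mathlib

open Polynomial

noncomputable section

/-- The Jacobi polynomial `P_n^{(α,β)}`, normalized by `P_n^{(α,β)}(1) = (α+1)_n / n!`, given by
its terminating hypergeometric series
`(α+1)_n / n! * ∑_k (-n)_k (n+α+β+1)_k / (k! (α+1)_k) * ((1-x)/2)^k`;
the terms with `k > n` vanish because `(-n)_k = 0`. Here `(a)_k = a (a+1) ⋯ (a+k-1)` is
`(ascPochhammer ℝ k).eval a`. -/
def jacobiP (n : ℕ) (α β : ℝ) : ℝ[X] :=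
  C ((ascPochhammer ℝ n).eval (α + 1) / (n.factorial : ℝ)) *
    ∑ k ∈ Finset.range (n + 1),
      C ((ascPochhammer ℝ k).eval (-(n : ℝ)) * (ascPochhammer ℝ k).eval ((n : ℝ) + α + β + 1) /
          ((k.factorial : ℝ) * (ascPochhammer ℝ k).eval (α + 1))) *
        (C (1 / 2 : ℝ) * (1 - X)) ^ k

/-- `φ_n^{(α,β)}(μ) = ∑_{k=0}^{⌊n/2⌋} (d^{2k}/dx^{2k} P_n^{(α,β)})(1) μ^k`. -/
def jacobiPhi (n : ℕ) (α β : ℝ) : ℝ[X] :=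
  ∑ k ∈ Finset.range (n / 2 + 1),
    C (((derivative^[2 * k]) (jacobiP n α β)).eval 1) * X ^ k

/-- `a < b` are two consecutive zeros of the real polynomial `g`. -/
def ConsecutiveZeros (g : ℝ[X]) (a b : ℝ) : Prop :=
  a < b ∧ g.IsRoot a ∧ g.IsRoot b ∧ ∀ c, a < c → c < b → ¬ g.IsRoot c

/-- The zeros of the real polynomials `g` and `h` interlace (strictly). -/
structure Interlace (g h : ℝ[X]) : Prop where
  /-- the polynomials are nonzero -/
  left_ne_zero : g ≠ 0
  right_ne_zero : h ≠ 0
  /-- all zeros of both polynomials are real: they split into linear factors over `ℝ` -/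
  left_real : g.Splits
  right_real : h.Splits
  /-- all zeros are simple -/
  left_simple : g.roots.Nodup
  right_simple : h.roots.Nodup
  /-- the two polynomials have no common zeros -/
  coprime : IsCoprime g h
  /-- between two consecutive zeros of `g` there is exactly one zero of `h` -/
  between_left : ∀ a b, ConsecutiveZeros g a b → ∃! c, a < c ∧ c < b ∧ h.IsRoot c
  /-- between two consecutive zeros of `h` there is exactly one zero of `g` -/
  between_right : ∀ a b, ConsecutiveZeros h a b → ∃! c, a < c ∧ c < b ∧ g.IsRoot c

end

/-!
The zeros of `jacobiPhi n α β` are studied through the polynomials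
`G n s = ∑ k, s ^ k * (d/dx)^k P_n (1)`, whose even and odd parts are `jacobiPhi n α β` and, up to
a constant factor, `jacobiPhi (n - 1) (α + 1) (β + 1)`: the derivative of a Jacobi polynomial is a
Jacobi polynomial with both parameters raised by one. Let `-1 < α < 0 < β`. The heart of the proof
is that on the imaginary half-axis `s = i y`, `y > 0`, the argument of `G (n + 1) (i y)` is ahead of
that of `G n (i y)` by an angle in `(0, π/2)`. Two such steps make an angle in `(0, π)`.

From this everything else is sign counting (`RotatingPair`). By induction on `n` the curve
`G n (i y)` crosses the coordinate axes exactly `n - 1` times, so that the even and the odd part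
have only real zeros; and as the argument of `G (n + 2)` is ahead of that of `G n` by an angle in
`(0, π)`, the even part of `G n` alternates in sign along the zeros of the even part of `G (n + 2)`,
and likewise for the odd parts. This gives both interlacing statements for `-1 < α < 0 < β`; the
range `0 < α < 1 < β` is the statement about the parameters raised by one.

The two bounds for the angle come from integrals, in the variable `t = (1 - x) / 2` with the weight
`t^α (1-t)^β` on `(0, 1)`. For `ν = y²` let `F` be the polynomial solution of `F + ν F'' = J`, where
`J` is the Jacobi polynomial of degree `n`; then, up to a rescaling of `y`, `G n (i y)` is the value
at `t = 0` of `f = F - i y F'`.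
* The weight is decreasing because `α < 0 < β`, so `∫ (|f|²)' w > 0` whenever `f` vanishes at `0`
  (`betaInt_derivative_sq_add_sq_pos`). For a combination of the functions `f` belonging to `n + 1`
  and `n` that vanishes at `0`, orthogonality evaluates the integral, and its sign says that the
  real part of `G (n + 1) * conj (G n)` is positive (`IsOrthogonalSequence.inner_pos`).
* If the imaginary part of `G (n + 1) * conj (G n)` were zero, a real combination `u` of the two
  solutions would have a double zero at `0`. Then `u' / t` has degree less than `n`, hence is
  orthogonal to `u + ν u''`, but both terms have a positive integral against it
  (`IsOrthogonalSequence.cross_ne_zero`). So the imaginary part has a constant sign, which is read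
  off as `ν → 0`.
-/

open MeasureTheory

/-! ### Zeros and sign changes of real polynomials -/

theorem sign_pos_of_mul_pos {s a b : ℝ} (h : 0 < s * a) (hab : 0 < a * b) : 0 < s * b := by
  by_contra hc
  have h1 : 0 < (s * a) * (a * b) := mul_pos h hab
  have h2 : (s * a) * (a * b) = a ^ 2 * (s * b) := by ring
  nlinarith [sq_nonneg a]

theorem pos_right_of_mul_pos {a b : ℝ} (ha : 0 ≤ a) (h : 0 < a * b) : 0 < b :=
  (pos_iff_pos_of_mul_pos h).1 (ha.lt_of_ne (by rintro rfl; simp at h))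

theorem mul_neg_of_signs {j : ℕ} {a b : ℝ} (ha : 0 < (-1) ^ j * a) (hb : 0 < (-1) ^ (j + 1) * b) :
    a * b < 0 := by
  have h := mul_pos ha hb
  have e : (-1 : ℝ) ^ j * (-1) ^ j = 1 := by rw [← mul_pow]; norm_num
  have : (-1) ^ j * a * ((-1) ^ (j + 1) * b) = -(((-1 : ℝ) ^ j * (-1) ^ j) * (a * b)) := by ring
  rw [this, e] at h
  linarith

theorem roots_eq_map_of_isRoot {f : ℝ[X]} {d : ℕ} {z : ℕ → ℝ} (hf : f ≠ 0)
    (hd : f.natDegree = d) (hz : Set.InjOn z (Set.Iio d)) (hr : ∀ i < d, f.IsRoot (z i)) :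
    f.roots = (Multiset.range d).map z := by
  have hnd : ((Multiset.range d).map z).Nodup := by
    refine Multiset.Nodup.map_on ?_ (Multiset.nodup_range d)
    intro x hx y hy h
    exact hz (by simpa using hx) (by simpa using hy) h
  have hle : (Multiset.range d).map z ≤ f.roots := by
    rw [Multiset.le_iff_subset hnd]
    intro x hx
    obtain ⟨i, hi, rfl⟩ := Multiset.mem_map.1 hx
    exact (mem_roots hf).2 (hr i (by simpa using hi))
  refine (Multiset.eq_of_le_of_card_le hle ?_).symm
  simpa [hd] using f.card_roots'

theorem eq_prod_of_isRoot {f : ℝ[X]} {d : ℕ} {z : ℕ → ℝ} (hf : f ≠ 0)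
    (hd : f.natDegree = d) (hz : Set.InjOn z (Set.Iio d)) (hr : ∀ i < d, f.IsRoot (z i)) :
    f = C f.leadingCoeff * ∏ i ∈ Finset.range d, (X - C (z i)) := by
  have h := roots_eq_map_of_isRoot hf hd hz hr
  have h2 := C_leadingCoeff_mul_prod_multiset_X_sub_C (p := f) (by simp [h, hd])
  rw [h, Multiset.map_map] at h2
  exact h2.symm

/-- A polynomial with the sign of `(-X)^d` at infinity and `d` real zeros has the sign `(-1)^i`
at a point lying above exactly `i` of them. -/
theorem sign_eval_of_isRoot {f : ℝ[X]} {d : ℕ} {z : ℕ → ℝ}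
    (hd : f.natDegree = d) (hl : 0 < (-1) ^ d * f.leadingCoeff)
    (hz : Set.InjOn z (Set.Iio d)) (hr : ∀ i < d, f.IsRoot (z i)) {i : ℕ} (hi : i ≤ d) {t : ℝ}
    (h₁ : ∀ j < i, z j < t) (h₂ : ∀ j < d, i ≤ j → t < z j) : 0 < (-1) ^ i * f.eval t := by
  have hf : f ≠ 0 := by rintro rfl; simp at hl
  rw [eq_prod_of_isRoot hf hd hz hr, eval_mul, eval_C, eval_prod]
  simp only [eval_sub, eval_X, eval_C]
  rw [← Finset.prod_range_mul_prod_Ico _ hi]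
  have e1 : 0 < ∏ k ∈ Finset.range i, (t - z k) :=
    Finset.prod_pos fun k hk => sub_pos.2 (h₁ k (Finset.mem_range.1 hk))
  have e2 : 0 < (-1) ^ (d - i) * ∏ k ∈ Finset.Ico i d, (t - z k) := by
    have : (-1 : ℝ) ^ (d - i) = ∏ k ∈ Finset.Ico i d, (-1 : ℝ) := by simp
    rw [this, ← Finset.prod_mul_distrib]
    refine Finset.prod_pos fun k hk => ?_
    rw [Finset.mem_Ico] at hk
    linarith [h₂ k hk.2 hk.1]
  have e3 : ((-1 : ℝ) ^ (d - i)) * (-1) ^ (d - i) = 1 := by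
    rw [← mul_pow]; norm_num
  have e4 : ((-1 : ℝ) ^ d) = (-1) ^ (d - i) * (-1) ^ i := by
    rw [← pow_add]; congr 1; omega
  have := mul_pos (mul_pos hl e1) e2
  rw [e4] at this
  refine this.trans_eq ?_
  linear_combination (-1) ^ i * f.leadingCoeff * (∏ k ∈ Finset.range i, (t - z k)) *
    (∏ k ∈ Finset.Ico i d, (t - z k)) * e3

theorem exists_isRoot_of_mul_neg {f : ℝ[X]} {a b : ℝ} (hab : a < b)
    (h : f.eval a * f.eval b < 0) : ∃ c, a < c ∧ c < b ∧ f.IsRoot c := by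
  rcases mul_neg_iff.1 h with ⟨ha, hb⟩ | ⟨ha, hb⟩
  · obtain ⟨c, hc, hc0⟩ := intermediate_value_Ioo' hab.le f.continuous.continuousOn ⟨hb, ha⟩
    exact ⟨c, hc.1, hc.2, hc0⟩
  · obtain ⟨c, hc, hc0⟩ := intermediate_value_Ioo hab.le f.continuous.continuousOn ⟨ha, hb⟩
    exact ⟨c, hc.1, hc.2, hc0⟩

theorem exists_forall_sign_eval (f : ℝ[X]) {d : ℕ}
    (hl : 0 < (-1) ^ d * f.leadingCoeff) : ∃ T : ℝ, ∀ t, T < t → 0 < (-1) ^ d * f.eval t := by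
  by_cases h0 : f.natDegree = 0
  · refine ⟨0, fun t _ => ?_⟩
    rw [eq_C_of_natDegree_eq_zero h0] at hl ⊢
    simpa using hl
  have h := tendsto_atTop_of_leadingCoeff_nonneg (C ((-1) ^ d) * f)
    (by
      rw [degree_C_mul (pow_ne_zero _ (by norm_num : (-1 : ℝ) ≠ 0))]
      exact natDegree_pos_iff_degree_pos.1 (Nat.pos_of_ne_zero h0)) (by simpa using hl.le)
  obtain ⟨T, hT⟩ := (h.eventually_gt_atTop 0).exists_forall_of_atTop
  exact ⟨T, fun t ht => by simpa using hT t ht.le⟩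

/-- If `h` has degree one less than `g` and alternates in sign along the zeros of `g`, which are
all real and simple, then the zeros of `g` and `h` interlace. -/
theorem interlace_of_alternating {g h : ℝ[X]} {d : ℕ} {z : ℕ → ℝ} (hg : g ≠ 0) (hh : h ≠ 0)
    (hd : g.natDegree = d + 1) (hd' : h.natDegree = d) (hz : StrictMonoOn z (Set.Iic d))
    (hr : ∀ i ≤ d, g.IsRoot (z i)) (ha : ∀ i < d, h.eval (z i) * h.eval (z (i + 1)) < 0)
    (h0 : ∀ i ≤ d, h.eval (z i) ≠ 0) :
    Interlace g h := by
  have hex : ∀ i, ∃ c, i < d → z i < c ∧ c < z (i + 1) ∧ h.IsRoot c := by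
    intro i
    by_cases hi : i < d
    · obtain ⟨c, hc⟩ := exists_isRoot_of_mul_neg
        (hz (by simpa using hi.le) (by simpa using hi) (Nat.lt_succ_self i)) (ha i hi)
      exact ⟨c, fun _ => hc⟩
    · exact ⟨0, fun h => absurd h hi⟩
  choose y hy using hex
  have hzm : ∀ i j, i ≤ j → j ≤ d → z i ≤ z j := fun i j hij hj =>
    hz.monotoneOn (by simpa using hij.trans hj) (by simpa using hj) hij
  have hym : StrictMonoOn y (Set.Iio d) := by
    intro i hi j hj hij
    simp only [Set.mem_Iio] at hi hj
    have := (hy i hi).2.1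
    have := (hy j hj).1
    have := hzm (i + 1) j hij hj.le
    linarith
  have hz' : Set.InjOn z (Set.Iio (d + 1)) := by
    rw [Set.Iio_add_one_eq_Iic]
    exact hz.injOn
  have hgr := roots_eq_map_of_isRoot hg hd hz' (fun i hi => hr i (Nat.lt_succ_iff.1 hi))
  have hhr := roots_eq_map_of_isRoot hh hd' hym.injOn (fun i hi => (hy i hi).2.2)
  have hgroot : ∀ x, g.IsRoot x ↔ ∃ i, i ≤ d ∧ z i = x := by
    intro x
    rw [← mem_roots hg, hgr]
    simp only [Multiset.mem_map, Multiset.mem_range, Nat.lt_succ_iff]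
  have hhroot : ∀ x, h.IsRoot x ↔ ∃ i, i < d ∧ y i = x := by
    intro x
    rw [← mem_roots hh, hhr]
    simp
  have hgs : g.Splits := splits_iff_card_roots.2 (by simp [hgr, hd])
  have hhs : h.Splits := splits_iff_card_roots.2 (by simp [hhr, hd'])
  refine ⟨hg, hh, hgs, hhs, ?_, ?_, ?_, ?_, ?_⟩
  · rw [hgr]
    exact Multiset.Nodup.map_on (fun a ha b hb h => hz' (Multiset.mem_range.1 ha) (Multiset.mem_range.1 hb) h)
      (Multiset.nodup_range _)
  · rw [hhr]
    exact Multiset.Nodup.map_on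
      (fun a ha b hb h => hym.injOn (by simpa using ha) (by simpa using hb) h)
      (Multiset.nodup_range _)
  · rw [eq_prod_of_isRoot hg hd hz' (fun i hi => hr i (Nat.lt_succ_iff.1 hi))]
    rw [isCoprime_mul_unit_left_left
      (isUnit_C.2 (isUnit_iff_ne_zero.2 (leadingCoeff_ne_zero.2 hg)))]
    refine IsCoprime.prod_left fun i hi => ?_
    rw [(irreducible_X_sub_C (z i)).coprime_iff_not_dvd, dvd_iff_isRoot]
    exact h0 i (Nat.lt_succ_iff.1 (Finset.mem_range.1 hi))
  · rintro a b ⟨hab, hga, hgb, hno⟩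
    obtain ⟨i, hi, rfl⟩ := (hgroot a).1 hga
    obtain ⟨j, hj, rfl⟩ := (hgroot b).1 hgb
    have hij : i < j := (hz.lt_iff_lt (by simpa using hi) (by simpa using hj)).1 hab
    have hj' : j = i + 1 := by
      by_contra hne
      have : i + 1 < j := by omega
      exact hno (z (i + 1)) (hz (by simpa using hi) (by simp; omega) (by omega))
        (hz (by simp; omega) (by simpa using hj) this) (hr _ (by omega))
    subst hj'
    obtain ⟨h1, h2, h3⟩ := hy i (by omega)
    refine ⟨y i, ⟨h1, h2, h3⟩, ?_⟩
    rintro c ⟨hc1, hc2, hc3⟩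
    obtain ⟨k, hk, rfl⟩ := (hhroot c).1 hc3
    obtain ⟨k1, k2, -⟩ := hy k hk
    rcases lt_trichotomy k i with hki | rfl | hki
    · linarith [hzm (k + 1) i hki hi]
    · rfl
    · linarith [hzm (i + 1) k hki hk.le]
  · rintro a b ⟨hab, hha, hhb, hno⟩
    obtain ⟨i, hi, rfl⟩ := (hhroot a).1 hha
    obtain ⟨j, hj, rfl⟩ := (hhroot b).1 hhb
    have hij : i < j := (hym.lt_iff_lt (by simpa using hi) (by simpa using hj)).1 hab
    have hj' : j = i + 1 := by
      by_contra hne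
      have : i + 1 < j := by omega
      exact hno (y (i + 1)) (hym (by simpa using hi) (by simp; omega) (by omega))
        (hym (by simp; omega) (by simpa using hj) this) (hy _ (by omega)).2.2
    subst hj'
    refine ⟨z (i + 1), ⟨(hy i hi).2.1, (hy (i + 1) hj).1, hr _ hj.le⟩, ?_⟩
    rintro c ⟨hc1, hc2, hc3⟩
    obtain ⟨k, hk, rfl⟩ := (hgroot c).1 hc3
    rcases lt_trichotomy k (i + 1) with hki | rfl | hki
    · linarith [hzm k i (by omega) hi.le, (hy i hi).1]
    · rfl
    · linarith [hzm (i + 2) k hki hk, (hy (i + 1) hj).2.1]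

/-! ### Pairs of sequences with rotating argument -/

/-- Two sequences `E`, `O` of real polynomials, thought of as the even and odd parts of
`G n (i y) = E n (y²) + i y O n (y²)`, such that the argument of `G n (i y)` exceeds the argument
of `G (n - 1) (i y)` by an angle in `(0, π/2)` for all `y > 0`: this is the meaning of the
signs of `cross` (an imaginary part) and `inner` (a real part). -/
structure RotatingPair (E O : ℕ → ℝ[X]) : Prop where
  natDegree_even : ∀ n, (E n).natDegree = n / 2
  natDegree_odd : ∀ n, (O n).natDegree = (n - 1) / 2
  leading_even : ∀ n, 0 < (-1) ^ (n / 2) * (E n).leadingCoeff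
  leading_odd : ∀ n, 0 < n → 0 < (-1) ^ ((n - 1) / 2) * (O n).leadingCoeff
  eval_zero : ∀ n, 0 < (E n).eval 0
  cross : ∀ n t, 0 < t →
    0 < (O (n + 1)).eval t * (E n).eval t - (E (n + 1)).eval t * (O n).eval t
  inner : ∀ n t, 0 < t →
    0 < (E (n + 1)).eval t * (E n).eval t + t * ((O (n + 1)).eval t * (O n).eval t)

namespace RotatingPair

variable {E O : ℕ → ℝ[X]}

/-- The points `τ 0 = 0 < τ 1 < τ 2 < ⋯` are the squares of the successive `y` at which
`G n (i y)` crosses the coordinate axes. -/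
structure IsCrossing (E O : ℕ → ℝ[X]) (n : ℕ) (τ : ℕ → ℝ) : Prop where
  zero : τ 0 = 0
  strictMono : StrictMono τ
  isRoot_even : ∀ j, 2 * j + 1 < n → (E n).IsRoot (τ (2 * j + 1))
  isRoot_odd : ∀ j, 2 * j + 2 < n → (O n).IsRoot (τ (2 * j + 2))

theorem IsCrossing.pos {n : ℕ} {τ : ℕ → ℝ} (hτ : IsCrossing E O n τ) (k : ℕ) :
    0 < τ (k + 1) := by
  rw [← hτ.zero]; exact hτ.strictMono (Nat.succ_pos k)

theorem sign_even (h : RotatingPair E O) {n : ℕ} {τ : ℕ → ℝ} (hτ : IsCrossing E O n τ) {j : ℕ}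
    (hj : 2 * j ≤ n) : 0 < (-1) ^ j * (E n).eval (τ (2 * j)) := by
  refine sign_eval_of_isRoot (z := fun i => τ (2 * i + 1)) (h.natDegree_even n) (h.leading_even n)
    ?_ ?_ (by omega) ?_ ?_
  · intro a _ b _ hab
    have := hτ.strictMono.injective hab
    omega
  · exact fun i hi => hτ.isRoot_even i (by omega)
  · exact fun i hi => hτ.strictMono (by omega)
  · exact fun i _ hi => hτ.strictMono (by omega)

theorem sign_odd (h : RotatingPair E O) {n : ℕ} {τ : ℕ → ℝ} (hτ : IsCrossing E O n τ) {j : ℕ}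
    (hj : 2 * j + 1 ≤ n) : 0 < (-1) ^ j * (O n).eval (τ (2 * j + 1)) := by
  refine sign_eval_of_isRoot (z := fun i => τ (2 * i + 2)) (h.natDegree_odd n)
    (h.leading_odd n (by omega)) ?_ ?_ (by omega) ?_ ?_
  · intro a _ b _ hab
    have := hτ.strictMono.injective hab
    omega
  · exact fun i hi => hτ.isRoot_odd i (by omega)
  · exact fun i hi => hτ.strictMono (by omega)
  · exact fun i _ hi => hτ.strictMono (by omega)

/-- All zeros of `E n` and `O n` are real, positive and simple, and they alternate. The `k`-th
crossing for `n + 1` lies between the `(k-1)`-st and the `k`-th for `n`; since `n` has only `n - 1`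
crossings, a point `τ n` beyond a prescribed bound stands in for the last one, at infinity. -/
theorem exists_isCrossing (h : RotatingPair E O) (n : ℕ) (T : ℝ) :
    ∃ τ, IsCrossing E O (n + 1) τ ∧ T < τ (n + 1) := by
  induction n generalizing T with
  | zero =>
    refine ⟨fun k => k * (|T| + 1), ⟨by simp, ?_, ?_, ?_⟩, ?_⟩
    · intro a b hab
      have : (a : ℝ) < b := by exact_mod_cast hab
      have := abs_nonneg T
      simp only
      nlinarith
    · intro j hj; omega
    · intro j hj; omega
    · simp only [zero_add, Nat.cast_one, one_mul]
      linarith [le_abs_self T]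
  | succ n ih =>
    -- Beyond `T₁` and `T₂` the polynomials for `n + 2` have the sign of their leading term.
    obtain ⟨T₁, hT₁⟩ := exists_forall_sign_eval _ (h.leading_even (n + 2))
    obtain ⟨T₂, hT₂⟩ := exists_forall_sign_eval _ (h.leading_odd (n + 2) (by omega))
    obtain ⟨τ, hτ, hT⟩ := ih (max T₁ T₂)
    have hT1 := hT₁ _ ((le_max_left _ _).trans_lt hT)
    have hT2 := hT₂ _ ((le_max_right _ _).trans_lt hT)
    have hE : ∀ j, 2 * j + 1 ≤ n + 1 →
        ∃ c, τ (2 * j) < c ∧ c < τ (2 * j + 1) ∧ (E (n + 2)).IsRoot c := by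
      intro j hj
      refine exists_isRoot_of_mul_neg (hτ.strictMono (by omega)) (mul_neg_of_signs (j := j) ?_ ?_)
      · rcases j with _ | j
        · simpa [hτ.zero] using h.eval_zero (n + 2)
        · have h1 := h.sign_even hτ (j := j + 1) (by omega)
          have h2 := h.inner (n + 1) _ (hτ.pos (2 * j + 1))
          have h3 : (O (n + 1)).eval (τ (2 * j + 2)) = 0 := hτ.isRoot_odd j (by omega)
          rw [h3, mul_zero, mul_zero, add_zero, mul_comm] at h2
          exact sign_pos_of_mul_pos h1 h2
      · rcases hj.lt_or_eq with hj | hj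
        · have h1 := h.sign_odd hτ (j := j) (by omega)
          have h2 := h.cross (n + 1) _ (hτ.pos (2 * j))
          have h3 : (E (n + 1)).eval (τ (2 * j + 1)) = 0 := hτ.isRoot_even j hj
          rw [h3] at h2
          have := sign_pos_of_mul_pos h1 (b := -(E (n + 2)).eval (τ (2 * j + 1))) (by linarith)
          rw [pow_succ]; linarith
        · have : (n + 2) / 2 = j + 1 := by omega
          rw [this, ← hj] at hT1
          exact hT1
    have hO : ∀ j, 2 * j + 2 ≤ n + 1 →
        ∃ c, τ (2 * j + 1) < c ∧ c < τ (2 * j + 2) ∧ (O (n + 2)).IsRoot c := by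
      intro j hj
      refine exists_isRoot_of_mul_neg (hτ.strictMono (by omega)) (mul_neg_of_signs (j := j) ?_ ?_)
      · have h1 := h.sign_odd hτ (j := j) (by omega)
        have h2 := h.inner (n + 1) _ (hτ.pos (2 * j))
        have h3 : (E (n + 1)).eval (τ (2 * j + 1)) = 0 := hτ.isRoot_even j (by omega)
        rw [h3, mul_zero, zero_add] at h2
        have := pos_right_of_mul_pos (hτ.pos (2 * j)).le h2
        exact sign_pos_of_mul_pos h1 (by linarith)
      · rcases hj.lt_or_eq with hj | hj
        · have h1 := h.sign_even hτ (j := j + 1) (by omega)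
          have h2 := h.cross (n + 1) _ (hτ.pos (2 * j + 1))
          have h3 : (O (n + 1)).eval (τ (2 * j + 2)) = 0 := hτ.isRoot_odd j hj
          rw [h3, mul_zero, sub_zero, mul_comm] at h2
          exact sign_pos_of_mul_pos h1 h2
        · have : (n + 2 - 1) / 2 = j + 1 := by omega
          rw [this, ← hj] at hT2
          exact hT2
    have hex : ∀ k, ∃ c, k ≤ n → τ k < c ∧ c < τ (k + 1) ∧
        (∀ j, k = 2 * j → (E (n + 2)).IsRoot c) ∧
        (∀ j, k = 2 * j + 1 → (O (n + 2)).IsRoot c) := by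
      intro k
      by_cases hk : k ≤ n
      · obtain ⟨j, rfl | rfl⟩ := Nat.even_or_odd' k
        · obtain ⟨c, h1, h2, h3⟩ := hE j (by omega)
          exact ⟨c, fun _ => ⟨h1, h2, fun _ _ => h3, fun i hi => by omega⟩⟩
        · obtain ⟨c, h1, h2, h3⟩ := hO j (by omega)
          exact ⟨c, fun _ => ⟨h1, h2, fun i hi => by omega, fun _ _ => h3⟩⟩
      · exact ⟨0, fun h => absurd h hk⟩
    choose σ hσ using hex
    have hm := le_max_left (τ (n + 1)) T
    have hm' := le_max_right (τ (n + 1)) T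
    refine ⟨fun k => if k = 0 then 0 else if k ≤ n + 1 then σ (k - 1)
      else max (τ (n + 1)) T + k, ⟨by simp, ?_, ?_, ?_⟩, ?_⟩
    · refine strictMono_nat_of_lt_succ fun k => ?_
      rcases k with _ | k
      · have := (hσ 0 (by omega)).1
        rw [hτ.zero] at this
        simpa using this
      · simp only [Nat.add_eq_zero_iff, one_ne_zero, and_false, if_false, Nat.add_sub_cancel]
        rcases lt_trichotomy k n with hk | rfl | hk
        · rw [if_pos (by omega), if_pos (by omega)]
          exact (hσ k hk.le).2.1.trans (hσ (k + 1) hk).1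
        · rw [if_pos le_rfl, if_neg (by omega)]
          have := (hσ k le_rfl).2.1
          have : (0 : ℝ) ≤ ((k + 1 + 1 : ℕ) : ℝ) := Nat.cast_nonneg _
          linarith
        · rw [if_neg (by omega), if_neg (by omega)]
          push_cast; linarith
    · intro j hj
      simp only [Nat.add_eq_zero_iff, one_ne_zero, and_false, if_false, Nat.add_sub_cancel]
      rw [if_pos (by omega)]
      exact (hσ (2 * j) (by omega)).2.2.1 j rfl
    · intro j hj
      have : 2 * j + 2 - 1 = 2 * j + 1 := by omega
      simp only [Nat.add_eq_zero_iff, OfNat.ofNat_ne_zero, and_false, if_false, this]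
      rw [if_pos (by omega)]
      exact (hσ (2 * j + 1) (by omega)).2.2.2 j rfl
    · have : (0 : ℝ) < ((n + 1 + 1 : ℕ) : ℝ) := Nat.cast_pos.2 (by omega)
      beta_reduce
      rw [if_neg (by omega), if_neg (by omega)]
      linarith

/-- Two consecutive rotations by angles in `(0, π/2)` make a rotation by an angle in `(0, π)`. -/
theorem cross_two (h : RotatingPair E O) (n : ℕ) {t : ℝ} (ht : 0 < t) :
    0 < (O (n + 2)).eval t * (E n).eval t - (E (n + 2)).eval t * (O n).eval t := by
  have c1 := h.cross n t ht
  have c2 := h.cross (n + 1) t ht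
  have i1 := h.inner n t ht
  have i2 := h.inner (n + 1) t ht
  have key := add_pos (mul_pos i2 c1) (mul_pos c2 i1)
  refine pos_right_of_mul_pos (a := (E (n + 1)).eval t ^ 2 + t * (O (n + 1)).eval t ^ 2)
    (by positivity) (key.trans_eq ?_)
  ring

/-- The substitution `x ↦ -κ x` turns positive zeros into negative ones and reverses their
order. -/
theorem interlace_comp_of_alternating {P Q : ℝ[X]} {d : ℕ} {z : ℕ → ℝ} (hP : P.natDegree = d + 1)
    (hQ : Q.natDegree = d) (hz : StrictMono z) (hr : ∀ i ≤ d, P.IsRoot (z i))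
    (ha : ∀ i ≤ d, 0 < (-1) ^ i * Q.eval (z i)) {κ a b : ℝ} (hκ : 0 < κ) (ha0 : a ≠ 0)
    (hb0 : b ≠ 0) :
    Interlace (C a * P.comp (C (-κ) * X)) (C b * Q.comp (C (-κ) * X)) := by
  have hP0 : P ≠ 0 := by rintro rfl; simp at hP
  have hQ0 : Q ≠ 0 := by rintro rfl; simpa using ha 0 (Nat.zero_le d)
  have hl : (C (-κ) * X : ℝ[X]).natDegree = 1 := natDegree_C_mul_X _ (neg_ne_zero.2 hκ.ne')
  have hne : ∀ {c : ℝ} {R : ℝ[X]}, c ≠ 0 → R ≠ 0 → C c * R.comp (C (-κ) * X) ≠ 0 := by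
    intro c R hc hR
    refine mul_ne_zero (C_ne_zero.2 hc) fun h => ?_
    rcases comp_eq_zero_iff.1 h with h | ⟨-, h⟩
    · exact hR h
    · rw [h, natDegree_C] at hl
      exact absurd hl (by norm_num)
  have hdeg : ∀ {c : ℝ} (R : ℝ[X]), c ≠ 0 →
      (C c * R.comp (C (-κ) * X)).natDegree = R.natDegree := by
    intro c R hc
    rw [natDegree_C_mul hc, natDegree_comp, hl, mul_one]
  have hev : ∀ (c : ℝ) (R : ℝ[X]) (x : ℝ),
      (C c * R.comp (C (-κ) * X)).eval (-x / κ) = c * R.eval x := by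
    intro c R x
    have : -κ * (-x / κ) = x := by field_simp
    simp only [eval_mul, eval_C, eval_comp, eval_X, this]
  refine interlace_of_alternating (d := d) (z := fun i => -z (d - i) / κ) (hne ha0 hP0)
    (hne hb0 hQ0) ((hdeg P ha0).trans hP) ((hdeg Q hb0).trans hQ) ?_ ?_ ?_ ?_
  · intro i hi j hj hij
    simp only [Set.mem_Iic] at hi hj
    have : z (d - j) < z (d - i) := hz (by omega)
    exact (div_lt_div_iff_of_pos_right hκ).2 (neg_lt_neg this)
  · intro i hi
    rw [IsRoot.def, hev, (hr (d - i) (by omega)).eq_zero, mul_zero]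
  · intro i hi
    rw [hev, hev]
    have e : d - i = d - (i + 1) + 1 := by omega
    have := mul_neg_of_signs (ha (d - (i + 1)) (by omega)) (e ▸ ha (d - i) (by omega))
    rw [e]
    have hb2 : 0 < b ^ 2 := by positivity
    nlinarith
  · intro i hi
    rw [hev]
    refine mul_ne_zero hb0 fun h => ?_
    have := ha (d - i) (by omega)
    rw [h, mul_zero] at this
    exact lt_irrefl _ this

theorem interlace_even (h : RotatingPair E O) (n : ℕ) {κ a b : ℝ} (hκ : 0 < κ) (ha : a ≠ 0)
    (hb : b ≠ 0) :
    Interlace (C a * (E (n + 2)).comp (C (-κ) * X)) (C b * (E n).comp (C (-κ) * X)) := by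
  obtain ⟨τ, hτ, -⟩ : ∃ τ, IsCrossing E O (n + 2) τ ∧ _ := h.exists_isCrossing (n + 1) 0
  have hE := h.natDegree_even (n + 2)
  refine interlace_comp_of_alternating (d := n / 2) (z := fun i => τ (2 * i + 1)) (by omega)
    (h.natDegree_even n) (fun i j hij => hτ.strictMono (by omega))
    (fun i hi => hτ.isRoot_even i (by omega)) (fun i hi => ?_) hκ ha hb
  have h1 := h.sign_odd hτ (j := i) (by omega)
  have h2 := h.cross_two n (hτ.pos (2 * i))
  have h3 : (E (n + 2)).eval (τ (2 * i + 1)) = 0 := hτ.isRoot_even i (by omega)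
  rw [h3, zero_mul, sub_zero] at h2
  exact sign_pos_of_mul_pos h1 h2

theorem interlace_odd (h : RotatingPair E O) (n : ℕ) {κ a b : ℝ} (hκ : 0 < κ) (ha : a ≠ 0)
    (hb : b ≠ 0) :
    Interlace (C a * (O (n + 3)).comp (C (-κ) * X)) (C b * (O (n + 1)).comp (C (-κ) * X)) := by
  obtain ⟨τ, hτ, -⟩ : ∃ τ, IsCrossing E O (n + 3) τ ∧ _ := h.exists_isCrossing (n + 2) 0
  have hO := h.natDegree_odd (n + 3)
  refine interlace_comp_of_alternating (d := n / 2) (z := fun i => τ (2 * i + 2)) (by omega)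
    (h.natDegree_odd (n + 1)) (fun i j hij => hτ.strictMono (by omega))
    (fun i hi => hτ.isRoot_odd i (by omega)) (fun i hi => ?_) hκ ha hb
  have h1 := h.sign_even hτ (j := i + 1) (by omega)
  have h2 := h.cross_two (n + 1) (hτ.pos (2 * i + 1))
  have h3 : (O (n + 3)).eval (τ (2 * i + 2)) = 0 := hτ.isRoot_odd i (by omega)
  rw [h3, zero_mul, zero_sub, ← mul_neg] at h2
  have h4 := sign_pos_of_mul_pos h1 h2
  rwa [pow_succ, mul_neg_one, neg_mul_neg] at h4

end RotatingPair

/-! ### Integration against the Beta weight -/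

/-- The Beta weight `t^a (1-t)^b` is integrable on `(0, 1)` for `a, b > -1`. -/
theorem intervalIntegrable_betaWeight {a b : ℝ} (ha : -1 < a) (hb : -1 < b) :
    IntervalIntegrable (fun t : ℝ => t ^ a * (1 - t) ^ b) volume 0 1 := by
  have half : ∀ {a b : ℝ}, -1 < a →
      IntervalIntegrable (fun t : ℝ => t ^ a * (1 - t) ^ b) volume 0 (1 / 2) := by
    intro a b ha
    refine (intervalIntegral.intervalIntegrable_rpow' ha).mul_continuousOn ?_
    intro t ht
    rw [Set.uIcc_of_le (by norm_num)] at ht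
    have : 1 - t ≠ 0 := by linarith [ht.2]
    exact ((continuousAt_const.sub continuousAt_id).rpow_const (Or.inl this)).continuousWithinAt
  refine (half ha).trans ?_
  have h := (half (a := b) (b := a) hb).comp_sub_left 1
  norm_num at h
  refine (IntervalIntegrable.symm h).congr ?_
  exact fun t _ => mul_comm ((1 - t) ^ b) (t ^ a)

/-- Integration of a polynomial against the Beta weight `t^a (1-t)^b` on `(0, 1)`. -/
noncomputable def betaInt (a b : ℝ) (p : ℝ[X]) : ℝ :=
  ∫ t in (0 : ℝ)..1, p.eval t * (t ^ a * (1 - t) ^ b)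

section

variable {a b : ℝ}

theorem intervalIntegrable_eval_mul_betaWeight (ha : -1 < a) (hb : -1 < b) (p : ℝ[X]) :
    IntervalIntegrable (fun t : ℝ => p.eval t * (t ^ a * (1 - t) ^ b)) volume 0 1 :=
  (intervalIntegrable_betaWeight ha hb).continuousOn_mul p.continuous.continuousOn

theorem betaInt_add (ha : -1 < a) (hb : -1 < b) (p q : ℝ[X]) :
    betaInt a b (p + q) = betaInt a b p + betaInt a b q := by
  unfold betaInt
  rw [← intervalIntegral.integral_add (intervalIntegrable_eval_mul_betaWeight ha hb p)
    (intervalIntegrable_eval_mul_betaWeight ha hb q)]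
  simp [add_mul]

theorem betaInt_C_mul (c : ℝ) (p : ℝ[X]) : betaInt a b (C c * p) = c * betaInt a b p := by
  unfold betaInt
  rw [← intervalIntegral.integral_const_mul]
  simp [mul_assoc]

theorem betaInt_X_mul (ha : -1 < a) (p : ℝ[X]) :
    betaInt a b (X * p) = betaInt (a + 1) b p := by
  unfold betaInt
  refine intervalIntegral.integral_congr fun t ht => ?_
  rw [Set.uIcc_of_le zero_le_one] at ht
  simp only [eval_mul, eval_X]
  rw [Real.rpow_add_one' ht.1 (by linarith)]
  ring

theorem betaInt_one_sub_X_mul (hb : -1 < b) (p : ℝ[X]) :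
    betaInt a b ((1 - X) * p) = betaInt a (b + 1) p := by
  unfold betaInt
  refine intervalIntegral.integral_congr fun t ht => ?_
  rw [Set.uIcc_of_le zero_le_one] at ht
  simp only [eval_mul, eval_sub, eval_one, eval_X]
  rw [Real.rpow_add_one' (sub_nonneg.2 ht.2) (by linarith)]
  ring

theorem betaInt_nonneg {p : ℝ[X]} (hp : ∀ t ∈ Set.Icc (0 : ℝ) 1, 0 ≤ p.eval t) :
    0 ≤ betaInt a b p := by
  refine intervalIntegral.integral_nonneg zero_le_one fun t ht => ?_
  exact mul_nonneg (hp t ht)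
    (mul_nonneg (Real.rpow_nonneg ht.1 _) (Real.rpow_nonneg (sub_nonneg.2 ht.2) _))

theorem betaInt_pos (ha : -1 < a) (hb : -1 < b) {p : ℝ[X]} (h0 : p ≠ 0)
    (hp : ∀ t ∈ Set.Icc (0 : ℝ) 1, 0 ≤ p.eval t) : 0 < betaInt a b p := by
  unfold betaInt
  rw [intervalIntegral.integral_of_le zero_le_one,
    setIntegral_pos_iff_support_of_nonneg_ae]
  · refine lt_of_lt_of_le ?_ (measure_mono (s := Set.Ioo 0 1 \ (p.roots.toFinset : Set ℝ)) ?_)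
    · rw [measure_sdiff_null (Set.Countable.measure_zero (Finset.countable_toSet _) _)]
      simp
    · rintro t ⟨ht, hr⟩
      refine ⟨?_, Set.Ioo_subset_Ioc_self ht⟩
      have h1 : p.eval t ≠ 0 := fun h => hr (by simp [h0, h])
      have h2 := (Real.rpow_pos_of_pos ht.1 a).ne'
      have h3 := (Real.rpow_pos_of_pos (sub_pos.2 ht.2) b).ne'
      exact mul_ne_zero h1 (mul_ne_zero h2 h3)
  · refine (ae_restrict_iff' measurableSet_Ioc).2 (Filter.Eventually.of_forall fun t ht => ?_)
    exact mul_nonneg (hp t ⟨ht.1.le, ht.2⟩)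
      (mul_nonneg (Real.rpow_nonneg ht.1.le _) (Real.rpow_nonneg (sub_nonneg.2 ht.2) _))
  · exact (intervalIntegrable_iff_integrableOn_Ioc_of_le zero_le_one).1
      (intervalIntegrable_eval_mul_betaWeight ha hb p)

/-- Integration by parts; the boundary terms vanish because both exponents are positive. -/
theorem betaInt_derivative (ha : 0 < a) (hb : 0 < b) (p : ℝ[X]) :
    betaInt a b (derivative p) = -a * betaInt (a - 1) b p + b * betaInt a (b - 1) p := by
  have i1 := intervalIntegrable_eval_mul_betaWeight (a := a) (b := b) (by linarith) (by linarith)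
    (derivative p)
  have i2 := (intervalIntegrable_eval_mul_betaWeight (a := a - 1) (b := b) (by linarith)
    (by linarith) p).const_mul a
  have i3 := (intervalIntegrable_eval_mul_betaWeight (a := a) (b := b - 1) (by linarith)
    (by linarith) p).const_mul b
  have key := intervalIntegral.integral_eq_sub_of_hasDerivAt_of_le (a := 0) (b := 1)
    (f := fun t : ℝ => p.eval t * (t ^ a * (1 - t) ^ b)) zero_le_one ?_ ?_ ((i1.add i2).sub i3)
  · rw [intervalIntegral.integral_sub (i1.add i2) i3, intervalIntegral.integral_add i1 i2,
      intervalIntegral.integral_const_mul, intervalIntegral.integral_const_mul] at key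
    simp only [sub_self, Real.zero_rpow ha.ne', Real.zero_rpow hb.ne', mul_zero, zero_mul] at key
    unfold betaInt
    linarith
  · refine Continuous.continuousOn (p.continuous.mul (Continuous.mul ?_ ?_))
    · exact Real.continuous_rpow_const ha.le
    · exact (continuous_const.sub continuous_id).rpow_const fun _ => Or.inr hb.le
  · intro t ht
    have d1 := (Real.hasDerivAt_rpow_const (p := a) (Or.inl ht.1.ne'))
    have d2 := ((hasDerivAt_id t).const_sub 1).rpow_const (p := b) (Or.inl (sub_pos.2 ht.2).ne')
    refine ((p.hasDerivAt t).mul (d1.mul d2)).congr_deriv ?_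
    simp only [id, Pi.mul_apply]
    ring

end

/-! ### Positivity and orthogonality -/

section

variable {a b : ℝ}

theorem betaInt_neg (p : ℝ[X]) : betaInt a b (-p) = -betaInt a b p := by
  have := betaInt_C_mul (a := a) (b := b) (-1) p
  simpa using this

theorem betaInt_sub (ha : -1 < a) (hb : -1 < b) (p q : ℝ[X]) :
    betaInt a b (p - q) = betaInt a b p - betaInt a b q := by
  rw [sub_eq_add_neg, betaInt_add ha hb, betaInt_neg, sub_eq_add_neg]

theorem betaInt_zero : betaInt a b 0 = 0 := by simp [betaInt]

/-- The Beta weight is decreasing when `a < 0 < b`, so that the integral of `(X r)'` is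
positive for nonnegative `r`. -/
theorem betaInt_derivative_X_mul (ha : -1 < a) (hb : 0 < b) {r : ℝ[X]}
    (hr : ∀ t ∈ Set.Icc (0 : ℝ) 1, 0 ≤ r.eval t) :
    -a * betaInt a b r ≤ betaInt a b (derivative (X * r)) := by
  have h1 := betaInt_derivative (a := a + 1) (by linarith) hb r
  have h2 := betaInt_nonneg (a := a + 1) (b := b - 1) hr
  rw [derivative_mul, derivative_X, one_mul, betaInt_add ha (by linarith), betaInt_X_mul ha, h1,
    add_sub_cancel_right]
  nlinarith

theorem betaInt_sq_pos (ha : -1 < a) (hb : -1 < b) {p : ℝ[X]} (hp : p ≠ 0) :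
    0 < betaInt a b (p ^ 2) :=
  betaInt_pos ha hb (pow_ne_zero 2 hp) fun t _ => by rw [eval_pow]; positivity

/-- A sum of squares vanishing at the origin has a derivative with positive integral. -/
theorem betaInt_derivative_sq_add_sq_pos (ha : -1 < a) (ha0 : a < 0) (hb : 0 < b) {ν : ℝ}
    (hν : 0 < ν) {U V : ℝ[X]} (hU : U.eval 0 = 0) (hV : V.eval 0 = 0) (hUV : U ≠ 0 ∨ V ≠ 0) :
    0 < betaInt a b (derivative (U ^ 2 + C ν * V ^ 2)) := by
  obtain ⟨u, rfl⟩ := X_dvd_iff.2 ((coeff_zero_eq_eval_zero U).trans hU)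
  obtain ⟨v, rfl⟩ := X_dvd_iff.2 ((coeff_zero_eq_eval_zero V).trans hV)
  have hb' : -1 < b := by linarith
  have ha1 : -1 < a + 1 := by linarith
  have e : (X * u) ^ 2 + C ν * (X * v) ^ 2 = X * (X * (u ^ 2 + C ν * v ^ 2)) := by ring
  have hn : ∀ t ∈ Set.Icc (0 : ℝ) 1, 0 ≤ (X * (u ^ 2 + C ν * v ^ 2)).eval t := by
    intro t ht
    simp only [eval_mul, eval_X, eval_add, eval_pow, eval_C]
    exact mul_nonneg ht.1 (by positivity)
  have h1 := betaInt_derivative_X_mul ha hb hn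
  have h2 : 0 < betaInt a b (X * (u ^ 2 + C ν * v ^ 2)) := by
    rw [betaInt_X_mul ha, betaInt_add ha1 hb', betaInt_C_mul]
    have nn : ∀ p : ℝ[X], 0 ≤ betaInt (a + 1) b (p ^ 2) := fun p =>
      betaInt_nonneg fun t _ => by rw [eval_pow]; positivity
    rcases hUV with h | h
    · have := betaInt_sq_pos ha1 hb' (right_ne_zero_of_mul h)
      have := mul_nonneg hν.le (nn v)
      linarith
    · have := mul_pos hν (betaInt_sq_pos ha1 hb' (right_ne_zero_of_mul h))
      linarith [nn u]
  rw [e]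
  nlinarith

/-- The integral of `k (X k)' = (k² + (X k²)') / 2` is nonnegative for the same reason. -/
theorem betaInt_mul_derivative_X_mul (ha : -1 < a) (hb : 0 < b) (k : ℝ[X]) :
    (1 - a) / 2 * betaInt a b (k ^ 2) ≤ betaInt a b (k * derivative (X * k)) := by
  have h1 := betaInt_derivative_X_mul ha hb (r := k ^ 2) fun t _ => by rw [eval_pow]; positivity
  have e : k * derivative (X * k) = C (1 / 2) * (k ^ 2 + derivative (X * k ^ 2)) := by
    have : (C (1 / 2) : ℝ[X]) * 2 = 1 := by
      rw [← C_ofNat, ← C_mul]; norm_num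
    simp only [derivative_mul, derivative_X, derivative_pow]
    simp only [Nat.cast_ofNat, map_ofNat]
    linear_combination (-(k ^ 2 + X * k * derivative k)) * this
  rw [e, betaInt_C_mul, betaInt_add ha (by linarith)]
  linarith

/-- The hypergeometric differential operator is symmetric with respect to the Beta weight. -/
theorem betaInt_hypergeometric_mul (ha : -1 < a) (hb : -1 < b) (p q : ℝ[X]) :
    betaInt a b ((X * (1 - X) * derivative (derivative p) +
      (C (a + 1) - C (a + b + 2) * X) * derivative p) * q) =
    -betaInt a b (X * (1 - X) * (derivative p * derivative q)) := by
  have h := betaInt_derivative (a := a + 1) (b := b + 1) (by linarith) (by linarith)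
    (derivative p * q)
  rw [add_sub_cancel_right, add_sub_cancel_right, ← betaInt_X_mul ha, ← betaInt_X_mul ha,
    ← betaInt_one_sub_X_mul hb, ← betaInt_one_sub_X_mul hb, ← betaInt_C_mul, ← betaInt_C_mul,
    ← betaInt_add ha hb] at h
  rw [← betaInt_neg, ← sub_eq_zero, ← betaInt_sub ha hb]
  rw [← sub_eq_zero, ← betaInt_sub ha hb] at h
  rw [← h]
  congr 1
  simp only [derivative_mul, map_add, map_neg, map_one, map_ofNat]
  ring

/-- A polynomial eigenfunction of the hypergeometric operator with eigenvalue that of degree `n`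
is orthogonal to all polynomials of lower degree. -/
theorem betaInt_mul_eq_zero (ha : -1 < a) (hb : -1 < b) (hab : -1 < a + b) {n : ℕ} {p : ℝ[X]}
    (hp : X * (1 - X) * derivative (derivative p) +
      (C (a + 1) - C (a + b + 2) * X) * derivative p = -C (n * (n + a + b + 1)) * p)
    {q : ℝ[X]} (hq : q.natDegree < n) : betaInt a b (p * q) = 0 := by
  have hX : ∀ m < n, betaInt a b (p * X ^ m) = 0 := by
    intro m
    induction m with
    | zero =>
      intro hn
      have h := betaInt_hypergeometric_mul ha hb p 1
      rw [hp, derivative_one, mul_zero, mul_zero, betaInt_zero, neg_zero, mul_one, ← C_neg,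
        betaInt_C_mul] at h
      have h0 : (0 : ℝ) < n := Nat.cast_pos.2 hn
      have : (0 : ℝ) < n * (n + a + b + 1) := mul_pos h0 (by linarith)
      rw [pow_zero, mul_one]
      exact (mul_eq_zero.1 h).resolve_left (by linarith)
    | succ m ih =>
      intro hm
      have h1 := betaInt_hypergeometric_mul ha hb p (X ^ (m + 1))
      have h2 := betaInt_hypergeometric_mul ha hb (X ^ (m + 1)) p
      have e : (X * (1 - X) * derivative (derivative (X ^ (m + 1))) +
          (C (a + 1) - C (a + b + 2) * X) * derivative (X ^ (m + 1))) * p =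
          C (-((m + 1) * (m + 1 + a + b + 1))) * (p * X ^ (m + 1)) +
          C ((m + 1) * (m + 1 + a)) * (p * X ^ m) := by
        have hX : X * derivative (X ^ m : ℝ[X]) = C (m : ℝ) * X ^ m := by
          rcases m with _ | m
          · simp
          · rw [derivative_X_pow, Nat.add_sub_cancel]
            ring
        rw [derivative_X_pow, Nat.add_sub_cancel, derivative_C_mul]
        simp only [Nat.cast_add, Nat.cast_one, map_add, map_neg, map_mul, map_one, map_ofNat] at hX ⊢
        linear_combination (1 - X) * (C (m : ℝ) + 1) * p * hX
      rw [e, betaInt_add ha hb, betaInt_C_mul, betaInt_C_mul, ih (by omega), mul_zero,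
        add_zero, mul_comm (derivative (X ^ (m + 1))), ← h1, hp, ← C_neg,
        mul_assoc, betaInt_C_mul] at h2
      have h3 : ((n : ℝ) * (n + a + b + 1) - (m + 1) * (m + 1 + a + b + 1)) *
          betaInt a b (p * X ^ (m + 1)) = 0 := by linarith
      refine (mul_eq_zero.1 h3).resolve_left ?_
      have hmn : (m : ℝ) + 1 < n := by exact_mod_cast hm
      have hm0 : (0 : ℝ) ≤ m := Nat.cast_nonneg m
      have : (n : ℝ) * (n + a + b + 1) - (m + 1) * (m + 1 + a + b + 1) =
        (n - (m + 1)) * (n + (m + 1) + (a + b) + 1) := by ring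
      rw [this]
      exact (mul_pos (by linarith) (by linarith)).ne'
  refine induction_with_natDegree_le (fun q => betaInt a b (p * q) = 0) (n - 1) ?_ ?_ ?_ q
    (by omega)
  · rw [mul_zero, betaInt_zero]
  · intro m r _ hm
    rw [mul_left_comm, betaInt_C_mul, hX m (by omega), mul_zero]
  · intro f g _ _ hf hg
    rw [mul_add, betaInt_add ha hb, hf, hg, add_zero]

end

/-! ### The equation `F + ν F'' = J` -/

/-- The truncated Neumann series of `(1 + ν D²)⁻¹ p`, where `D` is differentiation; it is exact
when `N` is at least the degree of `p`. -/
noncomputable def neumannSum (N : ℕ) (ν : ℝ) (p : ℝ[X]) : ℝ[X] :=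
  ∑ k ∈ Finset.range (N + 1), C ((-ν) ^ k) * derivative^[2 * k] p

/-- The polynomial in `ν` whose value at `ν` is that of `neumannSum N ν p` at the origin. -/
noncomputable def evenPart (N : ℕ) (p : ℝ[X]) : ℝ[X] :=
  ∑ k ∈ Finset.range (N + 1), C ((-1) ^ k * (derivative^[2 * k] p).eval 0) * X ^ k

theorem neumannSum_eval_zero (N : ℕ) (ν : ℝ) (p : ℝ[X]) :
    (neumannSum N ν p).eval 0 = (evenPart N p).eval ν := by
  simp only [neumannSum, evenPart, eval_finsetSum, eval_mul, eval_C, eval_pow, eval_X]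
  refine Finset.sum_congr rfl fun k _ => ?_
  rw [neg_pow ν]; ring

theorem derivative_neumannSum (N : ℕ) (ν : ℝ) (p : ℝ[X]) :
    derivative (neumannSum N ν p) = neumannSum N ν (derivative p) := by
  simp only [neumannSum, derivative_sum, derivative_C_mul]
  refine Finset.sum_congr rfl fun k _ => ?_
  rw [← Function.iterate_succ_apply' derivative, ← Function.iterate_succ_apply derivative]

theorem neumannSum_add {N : ℕ} {p : ℝ[X]} (h : p.natDegree ≤ N) (ν : ℝ) :
    neumannSum N ν p + C ν * derivative (derivative (neumannSum N ν p)) = p := by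
  have key := Finset.sum_range_sub' (fun k => C ((-ν) ^ k) * derivative^[2 * k] p) (N + 1)
  rw [iterate_derivative_eq_zero (by omega : p.natDegree < 2 * (N + 1))] at key
  simp only [pow_zero, map_one, mul_zero, Function.iterate_zero, id, one_mul, sub_zero] at key
  refine Eq.trans ?_ key
  rw [derivative_neumannSum, derivative_neumannSum, neumannSum, neumannSum, Finset.mul_sum,
    ← Finset.sum_add_distrib]
  refine Finset.sum_congr rfl fun k _ => ?_
  rw [mul_add, mul_one, Function.iterate_add_apply derivative (2 * k) 2]
  simp only [Function.iterate_succ, Function.iterate_zero, Function.comp, id]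
  rw [pow_succ, map_mul, C_neg]
  ring

theorem natDegree_neumannSum_le (N : ℕ) (ν : ℝ) (p : ℝ[X]) :
    (neumannSum N ν p).natDegree ≤ p.natDegree := by
  refine natDegree_sum_le_of_forall_le _ _ fun k _ => ?_
  exact (natDegree_C_mul_le _ _).trans ((natDegree_iterate_derivative p _).trans (Nat.sub_le _ _))

theorem coeff_neumannSum {N n : ℕ} {p : ℝ[X]} (h : p.natDegree ≤ N) (hn : p.natDegree ≤ n) (ν : ℝ) :
    (neumannSum N ν p).coeff n = p.coeff n := by
  conv_rhs => rw [← neumannSum_add h ν]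
  rw [coeff_add, coeff_C_mul, coeff_derivative, coeff_derivative,
    coeff_eq_zero_of_natDegree_lt (n := n + 1 + 1)
      (lt_of_le_of_lt (natDegree_neumannSum_le N ν p) (by omega))]
  simp

theorem coeff_evenPart (N : ℕ) (p : ℝ[X]) (k : ℕ) :
    (evenPart N p).coeff k = if k ≤ N then (-1) ^ k * (derivative^[2 * k] p).eval 0 else 0 := by
  simp only [evenPart, finsetSum_coeff, coeff_C_mul_X_pow, Finset.sum_ite_eq, Finset.mem_range,
    Nat.lt_succ_iff]

/-- The solutions `F`, `G` of `F + ν F'' = P`, `G + ν G'' = Q` of two polynomials turn the derivative of the real part of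
`(F - i√ν F') * conj (G - i√ν G')` into an expression of first order. -/
theorem derivative_mul_neumannSum {F G P Q : ℝ[X]} {ν : ℝ}
    (hF : F + C ν * derivative (derivative F) = P) (hG : G + C ν * derivative (derivative G) = Q) :
    derivative (F * G + C ν * (derivative F * derivative G)) =
      derivative F * Q + derivative G * P := by
  rw [← hF, ← hG]
  simp only [derivative_mul, derivative_add, derivative_C]
  ring

/-! ### The rotation of the argument for orthogonal polynomials -/

/-- What the argument uses of a sequence of orthogonal polynomials on `(0, 1)` for the weight
`t^a (1-t)^b`, normalized to be positive at the origin; `log_derivative` says that `-J'(0) / J(0)` increases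
with the degree. -/
structure IsOrthogonalSequence (a b : ℝ) (J : ℕ → ℝ[X]) : Prop where
  natDegree_le : ∀ n, (J n).natDegree ≤ n
  sign : ∀ n, ∀ k ≤ n, 0 < (-1) ^ k * (derivative^[k] (J n)).eval 0
  orthogonal : ∀ n q, q.natDegree < n → betaInt a b (J n * q) = 0
  log_derivative : ∀ n, 0 < (derivative (J n)).eval 0 * (J (n + 1)).eval 0 -
    (derivative (J (n + 1))).eval 0 * (J n).eval 0

namespace IsOrthogonalSequence

variable {a b : ℝ} {J : ℕ → ℝ[X]}

theorem coeff_sign (h : IsOrthogonalSequence a b J) (n : ℕ) : 0 < (-1) ^ n * (J n).coeff n := by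
  have h1 := h.sign n n le_rfl
  rw [← coeff_zero_eq_eval_zero, coeff_iterate_derivative, zero_add, nsmul_eq_mul,
    Nat.descFactorial_self] at h1
  have h2 : (0 : ℝ) < n.factorial := by positivity
  exact pos_right_of_mul_pos h2.le (by linarith)

theorem coeff_ne_zero (h : IsOrthogonalSequence a b J) (n : ℕ) : (J n).coeff n ≠ 0 := by
  intro h0
  have := h.coeff_sign n
  rw [h0, mul_zero] at this
  exact lt_irrefl _ this

theorem ne_zero (h : IsOrthogonalSequence a b J) (n : ℕ) : J n ≠ 0 := by
  intro h0
  exact h.coeff_ne_zero n (by rw [h0, coeff_zero])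

theorem betaInt_mul_derivative_neg (h : IsOrthogonalSequence a b J) (ha : -1 < a) (hb : -1 < b)
    (n : ℕ) : betaInt a b (J n * derivative (J (n + 1))) < 0 := by
  -- `r` is the ratio of the leading coefficients, which have opposite signs.
  set r : ℝ := (J (n + 1)).coeff (n + 1) * (n + 1) / (J n).coeff n with hr
  have hr0 : r < 0 := by
    have h1 := mul_neg_of_signs (h.coeff_sign n) (h.coeff_sign (n + 1))
    have h2 : r * (J n).coeff n ^ 2 =
        ((J n).coeff n * (J (n + 1)).coeff (n + 1)) * (n + 1) := by
      rw [hr]; field_simp [h.coeff_ne_zero n]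
    have h3 : (0 : ℝ) < n + 1 := by positivity
    nlinarith [sq_nonneg ((J n).coeff n)]
  have hq : betaInt a b (J n * (derivative (J (n + 1)) - C r * J n)) = 0 := by
    have hd : (derivative (J (n + 1)) - C r * J n).natDegree ≤ n := by
      refine (natDegree_sub_le _ _).trans (max_le ?_ ((natDegree_C_mul_le _ _).trans
        (h.natDegree_le n)))
      exact (natDegree_derivative_le _).trans (by have := h.natDegree_le (n + 1); omega)
    have hc : (derivative (J (n + 1)) - C r * J n).coeff n = 0 := by
      rw [coeff_sub, coeff_derivative, coeff_C_mul, hr, div_mul_cancel₀ _ (h.coeff_ne_zero n),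
        sub_self]
    rcases hd.lt_or_eq with hd | hd
    · exact h.orthogonal n _ hd
    · have : (derivative (J (n + 1)) - C r * J n) = 0 := by
        rw [← leadingCoeff_eq_zero, leadingCoeff, hd, hc]
      rw [this, mul_zero, betaInt_zero]
  have e : J n * derivative (J (n + 1)) =
      J n * (derivative (J (n + 1)) - C r * J n) + C r * J n ^ 2 := by ring
  rw [e, betaInt_add ha hb, hq, zero_add, betaInt_C_mul]
  exact mul_neg_of_neg_of_pos hr0 (betaInt_sq_pos ha hb (h.ne_zero n))

theorem betaInt_mul_derivative_derivative (h : IsOrthogonalSequence a b J) {n : ℕ} {q : ℝ[X]}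
    (hq : q.natDegree ≤ n + 1) : betaInt a b (J n * derivative (derivative q)) = 0 := by
  have d1 := natDegree_derivative_le q
  have d2 := natDegree_derivative_le (derivative q)
  rcases Nat.eq_zero_or_pos n with rfl | hn
  · have h0 : derivative (derivative q) = 0 := by
      rw [eq_C_of_natDegree_le_zero (p := derivative q) (by omega), derivative_C]
    rw [h0, mul_zero, betaInt_zero]
  · exact h.orthogonal n _ (by omega)

theorem betaInt_derivative_sq_add_sq (h : IsOrthogonalSequence a b J) (n : ℕ) {ν : ℝ} :
    betaInt a b (derivative (neumannSum n ν (J n) ^ 2 +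
      C ν * derivative (neumannSum n ν (J n)) ^ 2)) = 0 := by
  have hF := neumannSum_add (h.natDegree_le n) ν
  have hd := (natDegree_neumannSum_le n ν (J n)).trans (h.natDegree_le n)
  rw [sq, sq, derivative_mul_neumannSum hF hF]
  have e : derivative (neumannSum n ν (J n)) * J n + derivative (neumannSum n ν (J n)) * J n =
      C 2 * (J n * derivative (neumannSum n ν (J n))) := by
    simp only [map_ofNat]; ring
  rw [e, betaInt_C_mul]
  rcases Nat.eq_zero_or_pos n with rfl | hn
  · have h0 : derivative (neumannSum 0 ν (J 0)) = 0 := by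
      rw [eq_C_of_natDegree_le_zero hd, derivative_C]
    rw [h0, mul_zero, betaInt_zero, mul_zero]
  · rw [h.orthogonal n _ ((natDegree_derivative_le _).trans_lt (by omega)), mul_zero]

/-- The complex number `G n (i√ν) = F(0) - i√ν F'(0)` does not vanish. -/
theorem eval_zero_ne_zero (h : IsOrthogonalSequence a b J) (ha : -1 < a) (ha0 : a < 0)
    (hb : 0 < b) (n : ℕ) {ν : ℝ} (hν : 0 < ν) :
    (neumannSum n ν (J n)).eval 0 ≠ 0 ∨ (derivative (neumannSum n ν (J n))).eval 0 ≠ 0 := by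
  by_contra! hc
  have hne : neumannSum n ν (J n) ≠ 0 := by
    intro h0
    have := coeff_neumannSum (h.natDegree_le n) (h.natDegree_le n) ν
    rw [h0, coeff_zero] at this
    exact h.coeff_ne_zero n this.symm
  have := betaInt_derivative_sq_add_sq_pos ha ha0 hb hν hc.1 hc.2 (Or.inl hne)
  rw [h.betaInt_derivative_sq_add_sq n] at this
  exact lt_irrefl _ this

/-- The real part of `G (n+1) (i√ν) * conj (G n (i√ν))` is positive. The combination
`G n (i√ν) f (n+1) - G (n+1) (i√ν) f n` of the functions `f = F - i√ν F'` vanishes at the origin;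
its squared modulus is `U² + ν V²`, and the integral of the derivative of this is evaluated by
orthogonality. -/
theorem inner_pos (h : IsOrthogonalSequence a b J) (ha : -1 < a) (ha0 : a < 0)
    (hb : 0 < b) (n : ℕ) {ν : ℝ} (hν : 0 < ν) :
    0 < (neumannSum (n + 1) ν (J (n + 1))).eval 0 * (neumannSum n ν (J n)).eval 0 +
      ν * ((derivative (neumannSum (n + 1) ν (J (n + 1)))).eval 0 *
        (derivative (neumannSum n ν (J n))).eval 0) := by
  have hb' : -1 < b := by linarith
  have hF := neumannSum_add (h.natDegree_le (n + 1)) ν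
  have hG := neumannSum_add (h.natDegree_le n) ν
  have hFF := h.betaInt_derivative_sq_add_sq (n + 1) (ν := ν)
  have hGG := h.betaInt_derivative_sq_add_sq n (ν := ν)
  have hG0 := h.eval_zero_ne_zero ha ha0 hb n hν
  have hFc := coeff_neumannSum (h.natDegree_le (n + 1)) (h.natDegree_le (n + 1)) ν
  have hFd := (natDegree_neumannSum_le (n + 1) ν (J (n + 1))).trans (h.natDegree_le (n + 1))
  have hGd := (natDegree_neumannSum_le n ν (J n)).trans (h.natDegree_le n)
  have hneg := h.betaInt_mul_derivative_neg ha hb' n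
  set F := neumannSum (n + 1) ν (J (n + 1))
  set G := neumannSum n ν (J n)
  have hFG : betaInt a b (derivative (F * G + C ν * (derivative F * derivative G))) =
      betaInt a b (J n * derivative (J (n + 1))) := by
    rw [derivative_mul_neumannSum hF hG, betaInt_add ha hb', mul_comm (derivative G),
      h.orthogonal (n + 1) _ ((natDegree_derivative_le _).trans_lt (by omega)), add_zero]
    have e : derivative F * J n =
        J n * derivative (J (n + 1)) -
          C ν * (J n * derivative (derivative (derivative F))) := by
      rw [← hF]
      simp only [derivative_add, derivative_mul, derivative_C]
      ring
    rw [e, betaInt_sub ha hb', betaInt_C_mul]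
    rw [h.betaInt_mul_derivative_derivative (natDegree_derivative_le F |>.trans (by omega)),
      mul_zero, sub_zero]
  set e := F.eval 0
  set d := (derivative F).eval 0
  set e₁ := G.eval 0
  set d₁ := (derivative G).eval 0
  set U : ℝ[X] := C e₁ * F - C (ν * d₁) * derivative F - C e * G + C (ν * d) * derivative G with hU
  set V : ℝ[X] := C e₁ * derivative F + C d₁ * F - C e * derivative G - C d * G with hV
  have hU0 : U.eval 0 = 0 := by
    simp only [hU, eval_add, eval_sub, eval_mul, eval_C]
    ring
  have hV0 : V.eval 0 = 0 := by
    simp only [hV, eval_add, eval_sub, eval_mul, eval_C]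
    ring
  have z1 : G.coeff (n + 1) = 0 := coeff_eq_zero_of_natDegree_lt (by omega)
  have z2 : (derivative G).coeff (n + 1) = 0 :=
    coeff_eq_zero_of_natDegree_lt ((natDegree_derivative_le _).trans_lt (by omega))
  have z3 : (derivative F).coeff (n + 1) = 0 :=
    coeff_eq_zero_of_natDegree_lt ((natDegree_derivative_le _).trans_lt (by omega))
  have hUV : U ≠ 0 ∨ V ≠ 0 := by
    rcases hG0 with h0 | h0
    · left
      intro hz
      have := congrArg (fun p => p.coeff (n + 1)) hz
      simp only [hU, coeff_add, coeff_sub, coeff_C_mul, z1, z2, z3, hFc, coeff_zero, mul_zero,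
        sub_zero, add_zero] at this
      exact mul_ne_zero h0 (h.coeff_ne_zero _) this
    · right
      intro hz
      have := congrArg (fun p => p.coeff (n + 1)) hz
      simp only [hV, coeff_add, coeff_sub, coeff_C_mul, z1, z2, z3, hFc, coeff_zero, mul_zero,
        sub_zero, zero_add] at this
      exact mul_ne_zero h0 (h.coeff_ne_zero _) this
  have hpos := betaInt_derivative_sq_add_sq_pos ha ha0 hb hν hU0 hV0 hUV
  have key : U ^ 2 + C ν * V ^ 2 =
      C (e₁ ^ 2 + ν * d₁ ^ 2) * (F ^ 2 + C ν * derivative F ^ 2) +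
      C (e ^ 2 + ν * d ^ 2) * (G ^ 2 + C ν * derivative G ^ 2) +
      (C (-2 * (e * e₁ + ν * (d * d₁))) * (F * G + C ν * (derivative F * derivative G)) +
       C (2 * ν * (e * d₁ - d * e₁)) * (derivative F * G - F * derivative G)) := by
    simp only [hU, hV, map_add, map_sub, map_mul, map_neg, map_pow, map_ofNat]
    ring
  have hIm : betaInt a b (derivative (derivative F * G - F * derivative G)) = 0 := by
    have e1 : C ν * derivative (derivative F * G - F * derivative G) =
        J (n + 1) * G - J n * J (n + 1) + C ν * (J n * derivative (derivative F)) := by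
      conv_rhs => rw [← hF, ← hG]
      simp only [derivative_sub, derivative_mul]
      ring
    have e2 := congrArg (betaInt a b) e1
    rw [betaInt_C_mul, betaInt_add ha hb', betaInt_sub ha hb', betaInt_C_mul,
      h.betaInt_mul_derivative_derivative hFd, h.orthogonal (n + 1) G (by omega),
      mul_comm (J n), h.orthogonal (n + 1) (J n) ((h.natDegree_le n).trans_lt (by omega))] at e2
    simpa [hν.ne'] using e2
  rw [key] at hpos
  rw [derivative_add, derivative_add, derivative_add, derivative_C_mul, derivative_C_mul,
    derivative_C_mul, derivative_C_mul, betaInt_add ha hb', betaInt_add ha hb',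
    betaInt_add ha hb', betaInt_C_mul, betaInt_C_mul, betaInt_C_mul, betaInt_C_mul] at hpos
  rw [hFF, hGG, hFG, hIm] at hpos
  nlinarith

/-- `G (n+1) (i√ν) * conj (G n (i√ν))` is not real. Otherwise a real combination `u` of the two
solutions has a double zero at the origin, and integration against `u' / X`, a polynomial of
degree less than `n`, leads to a contradiction. -/
theorem cross_ne_zero (h : IsOrthogonalSequence a b J) (ha : -1 < a) (ha0 : a < 0)
    (hb : 0 < b) (n : ℕ) {ν : ℝ} (hν : 0 < ν) :
    (derivative (neumannSum (n + 1) ν (J (n + 1)))).eval 0 * (neumannSum n ν (J n)).eval 0 -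
      (neumannSum (n + 1) ν (J (n + 1))).eval 0 * (derivative (neumannSum n ν (J n))).eval 0
      ≠ 0 := by
  intro hc
  have hb' : -1 < b := by linarith
  have hF := neumannSum_add (h.natDegree_le (n + 1)) ν
  have hG := neumannSum_add (h.natDegree_le n) ν
  have hG0 := h.eval_zero_ne_zero ha ha0 hb n hν
  have hFc := coeff_neumannSum (h.natDegree_le (n + 1)) (h.natDegree_le (n + 1)) ν
  have hFd := (natDegree_neumannSum_le (n + 1) ν (J (n + 1))).trans (h.natDegree_le (n + 1))
  have hGd := (natDegree_neumannSum_le n ν (J n)).trans (h.natDegree_le n)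
  set F := neumannSum (n + 1) ν (J (n + 1))
  set G := neumannSum n ν (J n)
  set e := F.eval 0
  set d := (derivative F).eval 0
  set e₁ := G.eval 0
  set d₁ := (derivative G).eval 0
  -- These coefficients come from projecting `(e, d)` on the parallel vector `(e₁, d₁)`; unlike
  -- `(d₁, -d)` they do not degenerate when `d = d₁ = 0`.
  set x := e₁ ^ 2 + ν * d₁ ^ 2 with hx
  set y := -(e * e₁ + ν * (d * d₁)) with hy
  have hx0 : 0 < x := by
    rcases hG0 with h0 | h0
    · have : 0 < e₁ ^ 2 := by positivity
      have : 0 ≤ ν * d₁ ^ 2 := by positivity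
      linarith
    · have : 0 < ν * d₁ ^ 2 := by positivity
      have : 0 ≤ e₁ ^ 2 := by positivity
      linarith
  obtain ⟨u, hu⟩ : ∃ u, u = C x * F + C y * G := ⟨_, rfl⟩
  have hu0 : u.eval 0 = 0 := by
    rw [hu]; simp only [eval_add, eval_mul, eval_C]
    change x * e + y * e₁ = 0
    rw [hx, hy]; linear_combination (-(ν * d₁)) * hc
  have hu1 : (derivative u).eval 0 = 0 := by
    rw [hu]; simp only [derivative_add, derivative_C_mul, eval_add, eval_mul, eval_C]
    change x * d + y * d₁ = 0
    rw [hx, hy]; linear_combination e₁ * hc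
  have hune : u.coeff (n + 1) ≠ 0 := by
    rw [hu, coeff_add, coeff_C_mul, coeff_C_mul, hFc,
      coeff_eq_zero_of_natDegree_lt (p := G) (by omega), mul_zero, add_zero]
    exact mul_ne_zero hx0.ne' (h.coeff_ne_zero _)
  have hud : u.natDegree ≤ n + 1 := by
    rw [hu]
    exact natDegree_add_le_of_degree_le ((natDegree_C_mul_le _ _).trans hFd)
      ((natDegree_C_mul_le _ _).trans (by omega))
  have hQ : u + C ν * derivative (derivative u) = C x * J (n + 1) + C y * J n := by
    rw [← hF, ← hG, hu]
    simp only [derivative_add, derivative_C_mul]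
    ring
  obtain ⟨w, hw⟩ := X_dvd_iff.2 ((coeff_zero_eq_eval_zero u).trans hu0)
  have hw0 : w.eval 0 = 0 := by
    rw [hw] at hu1
    simpa using hu1
  obtain ⟨v, hv⟩ := X_dvd_iff.2 ((coeff_zero_eq_eval_zero w).trans hw0)
  have hvne : v ≠ 0 := by
    rintro rfl
    rw [hw, hv] at hune
    simp at hune
  have hvd : v.natDegree < n := by
    have : u.natDegree = v.natDegree + 2 := by
      rw [hw, hv, natDegree_X_mul (mul_ne_zero X_ne_zero hvne), natDegree_X_mul hvne]
    omega
  set k := 2 * v + X * derivative v with hk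
  have hkd : k.natDegree < n := by
    refine lt_of_le_of_lt (natDegree_add_le_of_degree_le (n := v.natDegree) ?_ ?_) hvd
    · rw [← C_ofNat]; exact natDegree_C_mul_le _ _
    · rcases Nat.eq_zero_or_pos v.natDegree with h0 | h0
      · rw [eq_C_of_natDegree_eq_zero h0]; simp
      · refine natDegree_mul_le.trans ?_
        have := natDegree_derivative_le v
        rw [natDegree_X]; omega
  have hdu : derivative u = X * k := by
    rw [hw, hv, hk]
    simp only [derivative_mul, derivative_X]
    ring
  have hdw : derivative (X * w) = X * k := by rw [← hw, hdu]
  have h1 : betaInt a b ((C x * J (n + 1) + C y * J n) * k) = 0 := by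
    rw [add_mul, betaInt_add ha hb', mul_assoc, mul_assoc, betaInt_C_mul, betaInt_C_mul,
      h.orthogonal (n + 1) k (by omega), h.orthogonal n k hkd]
    simp
  have h2 : (C x * J (n + 1) + C y * J n) * k =
      w * derivative (X * w) + C ν * (k * derivative (X * k)) := by
    rw [← hQ, hdw, hdu, hw]; ring
  rw [h2, betaInt_add ha hb', betaInt_C_mul] at h1
  have h3 := betaInt_mul_derivative_X_mul ha hb w
  have h4 := betaInt_mul_derivative_X_mul ha hb k
  have h5 : 0 < betaInt a b (w ^ 2) :=
    betaInt_sq_pos ha hb' (by rw [hv]; exact mul_ne_zero X_ne_zero hvne)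
  have h6 : 0 ≤ betaInt a b (k ^ 2) := betaInt_nonneg fun t _ => by rw [eval_pow]; positivity
  have h7 : 0 < (1 - a) / 2 * betaInt a b (w ^ 2) := mul_pos (by linarith) h5
  have h8 : 0 ≤ (1 - a) / 2 * betaInt a b (k ^ 2) := mul_nonneg (by linarith) h6
  have h9 := mul_nonneg hν.le (h8.trans h4)
  linarith

theorem cross_pos (h : IsOrthogonalSequence a b J) (ha : -1 < a) (ha0 : a < 0)
    (hb : 0 < b) (n : ℕ) {ν : ℝ} (hν : 0 < ν) :
    0 < (-evenPart (n + 1) (derivative (J (n + 1)))).eval ν * (evenPart n (J n)).eval ν -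
      (evenPart (n + 1) (J (n + 1))).eval ν * (-evenPart n (derivative (J n))).eval ν := by
  -- `D` has no zero at positive `ν`, so its sign is the one at `ν = 0`.
  set D : ℝ[X] := -evenPart (n + 1) (derivative (J (n + 1))) * evenPart n (J n) -
      evenPart (n + 1) (J (n + 1)) * -evenPart n (derivative (J n)) with hD
  have hDe : ∀ t, D.eval t = (-evenPart (n + 1) (derivative (J (n + 1)))).eval t *
      (evenPart n (J n)).eval t -
      (evenPart (n + 1) (J (n + 1))).eval t * (-evenPart n (derivative (J n))).eval t := by
    intro t; rw [hD, eval_sub, eval_mul, eval_mul]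
  rw [← hDe]
  have hne : ∀ t, 0 < t → D.eval t ≠ 0 := by
    intro t ht h0
    apply h.cross_ne_zero ha ha0 hb n ht
    rw [derivative_neumannSum, derivative_neumannSum, neumannSum_eval_zero, neumannSum_eval_zero,
      neumannSum_eval_zero, neumannSum_eval_zero]
    rw [hDe, eval_neg, eval_neg] at h0
    linarith
  have ev0 : ∀ N p, (evenPart N p).eval 0 = p.eval 0 := by
    intro N p
    rw [← coeff_zero_eq_eval_zero, coeff_evenPart]
    simp
  have h0 : 0 < D.eval 0 := by
    rw [hDe, eval_neg, eval_neg, ev0, ev0, ev0, ev0]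
    linarith [h.log_derivative n]
  by_contra hc
  obtain ⟨t, ht, ht0⟩ := exists_isRoot_of_mul_neg hν
    (mul_neg_of_pos_of_neg h0 ((not_lt.1 hc).lt_of_ne (hne ν hν)))
  exact hne t ht ht0.2

/-- The even and odd parts attached to an orthogonal sequence. The minus sign makes the odd parts
positive at the origin, since `t = (1 - x) / 2` reverses the orientation. -/
theorem rotatingPair (h : IsOrthogonalSequence a b J) (ha : -1 < a) (ha0 : a < 0) (hb : 0 < b) :
    RotatingPair (fun n => evenPart n (J n)) (fun n => -evenPart n (derivative (J n))) := by
  have pm : ∀ k : ℕ, (-1 : ℝ) ^ k * (-1) ^ k = 1 := fun k => by rw [← mul_pow]; norm_num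
  have cE : ∀ n, 0 < (-1) ^ (n / 2) * (evenPart n (J n)).coeff (n / 2) := by
    intro n
    rw [coeff_evenPart, if_pos (by omega), ← mul_assoc, pm, one_mul]
    have := h.sign n (2 * (n / 2)) (by omega)
    rwa [pow_mul, neg_one_sq, one_pow, one_mul] at this
  have cO : ∀ n, 0 < n →
      0 < (-1) ^ ((n - 1) / 2) * (-evenPart n (derivative (J n))).coeff ((n - 1) / 2) := by
    intro n hn
    rw [coeff_neg, coeff_evenPart, if_pos (by omega), mul_neg, ← mul_assoc, pm, one_mul,
      ← Function.iterate_succ_apply]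
    have := h.sign n (2 * ((n - 1) / 2) + 1) (by omega)
    rw [pow_succ, pow_mul, neg_one_sq, one_pow, one_mul] at this
    linarith
  have dE : ∀ n, (evenPart n (J n)).natDegree = n / 2 := by
    intro n
    refine natDegree_eq_of_le_of_coeff_ne_zero ?_ (right_ne_zero_of_mul (cE n).ne')
    refine natDegree_le_iff_coeff_eq_zero.2 fun k hk => ?_
    rw [coeff_evenPart]
    split_ifs
    · rw [iterate_derivative_eq_zero ((h.natDegree_le n).trans_lt (by omega)), eval_zero, mul_zero]
    · rfl
  have dO : ∀ n, (-evenPart n (derivative (J n))).natDegree = (n - 1) / 2 := by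
    intro n
    have hle : (-evenPart n (derivative (J n))).natDegree ≤ (n - 1) / 2 := by
      refine natDegree_le_iff_coeff_eq_zero.2 fun k hk => ?_
      rw [coeff_neg, coeff_evenPart]
      split_ifs
      · rw [← Function.iterate_succ_apply,
          iterate_derivative_eq_zero ((h.natDegree_le n).trans_lt (by omega)), eval_zero,
          mul_zero, neg_zero]
      · exact neg_zero
    rcases Nat.eq_zero_or_pos n with rfl | hn
    · exact Nat.le_zero.1 hle
    · exact natDegree_eq_of_le_of_coeff_ne_zero hle (right_ne_zero_of_mul (cO n hn).ne')
  refine ⟨dE, dO, ?_, ?_, ?_, fun n t ht => h.cross_pos ha ha0 hb n ht, ?_⟩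
  · intro n
    rw [leadingCoeff, dE]; exact cE n
  · intro n hn
    rw [leadingCoeff, dO]; exact cO n hn
  · intro n
    simpa [← coeff_zero_eq_eval_zero, coeff_evenPart] using h.sign n 0 (Nat.zero_le n)
  · intro n t ht
    have := h.inner_pos ha ha0 hb n ht
    simp only [derivative_neumannSum, neumannSum_eval_zero] at this
    simpa using this

end IsOrthogonalSequence

/-! ### Jacobi polynomials -/

/-- The coefficient of `t^k` in `t ↦ P_n^{(α,β)}(1 - 2t)`. -/
noncomputable def shiftedJacobiCoeff (α β : ℝ) (n k : ℕ) : ℝ :=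
  (ascPochhammer ℝ n).eval (α + 1) / (n.factorial : ℝ) *
    ((ascPochhammer ℝ k).eval (-(n : ℝ)) * (ascPochhammer ℝ k).eval ((n : ℝ) + α + β + 1) /
      ((k.factorial : ℝ) * (ascPochhammer ℝ k).eval (α + 1)))

/-- The Jacobi polynomial on `(0, 1)`, `t ↦ P_n^{(α,β)}(1 - 2t)`. -/
noncomputable def shiftedJacobi (α β : ℝ) (n : ℕ) : ℝ[X] :=
  ∑ k ∈ Finset.range (n + 1), C (shiftedJacobiCoeff α β n k) * X ^ k

section

variable {α β : ℝ}

theorem coeff_shiftedJacobi (n k : ℕ) :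
    (shiftedJacobi α β n).coeff k = shiftedJacobiCoeff α β n k := by
  simp only [shiftedJacobi, finsetSum_coeff, coeff_C_mul_X_pow, Finset.sum_ite_eq,
    Finset.mem_range]
  split_ifs with h
  · rfl
  · rw [shiftedJacobiCoeff, ascPochhammer_eval_neg_coe_nat_of_lt (by omega)]
    simp

theorem natDegree_shiftedJacobi_le (n : ℕ) : (shiftedJacobi α β n).natDegree ≤ n :=
  natDegree_sum_le_of_forall_le _ _ fun _ hk =>
    (natDegree_C_mul_X_pow_le _ _).trans (Nat.lt_succ_iff.1 (Finset.mem_range.1 hk))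

theorem eval_zero_iterate_derivative (p : ℝ[X]) (k : ℕ) :
    (derivative^[k] p).eval 0 = k.factorial * p.coeff k := by
  rw [← coeff_zero_eq_eval_zero, coeff_iterate_derivative, zero_add, nsmul_eq_mul,
    Nat.descFactorial_self]

theorem ascPochhammer_eval_neg_sign {n k : ℕ} (h : k ≤ n) :
    0 < (-1) ^ k * (ascPochhammer ℝ k).eval (-(n : ℝ)) := by
  induction k with
  | zero => simp
  | succ k ih =>
    rw [ascPochhammer_succ_eval]
    have h1 := ih (by omega)
    have h2 : (k : ℝ) + 1 ≤ n := by exact_mod_cast h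
    have : (-1) ^ (k + 1) * ((ascPochhammer ℝ k).eval (-(n : ℝ)) * (-(n : ℝ) + k)) =
      (-1) ^ k * (ascPochhammer ℝ k).eval (-(n : ℝ)) * (n - k) := by ring
    rw [this]
    exact mul_pos h1 (by linarith)

theorem shiftedJacobiCoeff_sign (hα : -1 < α) (hβ : 0 < β) {n k : ℕ} (h : k ≤ n) :
    0 < (-1) ^ k * shiftedJacobiCoeff α β n k := by
  have h0 := ascPochhammer_pos n (α + 1) (by linarith)
  have h1 := ascPochhammer_pos k (α + 1) (by linarith)
  have h2 : 0 < (ascPochhammer ℝ k).eval ((n : ℝ) + α + β + 1) :=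
    ascPochhammer_pos k _ (by have : (0 : ℝ) ≤ n := Nat.cast_nonneg n; linarith)
  have h3 := ascPochhammer_eval_neg_sign h
  have : (-1) ^ k * shiftedJacobiCoeff α β n k =
      (ascPochhammer ℝ n).eval (α + 1) / (n.factorial : ℝ) *
    (((-1) ^ k * (ascPochhammer ℝ k).eval (-(n : ℝ))) *
      (ascPochhammer ℝ k).eval ((n : ℝ) + α + β + 1) /
      ((k.factorial : ℝ) * (ascPochhammer ℝ k).eval (α + 1))) := by
    rw [shiftedJacobiCoeff]; ring
  rw [this]
  positivity

theorem shiftedJacobiCoeff_succ (hα : -1 < α) (n k : ℕ) :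
    ((k : ℝ) + 1) * (k + 1 + α) * shiftedJacobiCoeff α β n (k + 1) =
      ((k : ℝ) - n) * (k + n + α + β + 1) * shiftedJacobiCoeff α β n k := by
  have h1 := (ascPochhammer_pos k (α + 1) (by linarith)).ne'
  have h2 : (α + 1 + k : ℝ) ≠ 0 := by
    have : (0 : ℝ) ≤ k := Nat.cast_nonneg k
    linarith
  have h3 : ((k : ℝ) + 1) ≠ 0 := by positivity
  have h4 : (k.factorial : ℝ) ≠ 0 := by positivity
  simp only [shiftedJacobiCoeff, ascPochhammer_succ_eval, Nat.factorial_succ, Nat.cast_mul,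
    Nat.cast_add, Nat.cast_one]
  field_simp
  ring

theorem shiftedJacobi_ode (hα : -1 < α) (n : ℕ) :
    X * (1 - X) * derivative (derivative (shiftedJacobi α β n)) +
      (C (α + 1) - C (α + β + 2) * X) * derivative (shiftedJacobi α β n) =
      -C (n * (n + α + β + 1)) * shiftedJacobi α β n := by
  ext k
  have e : X * (1 - X) * derivative (derivative (shiftedJacobi α β n)) +
      (C (α + 1) - C (α + β + 2) * X) * derivative (shiftedJacobi α β n) =
      X * derivative (derivative (shiftedJacobi α β n)) -
      X * (X * derivative (derivative (shiftedJacobi α β n))) +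
      C (α + 1) * derivative (shiftedJacobi α β n) -
      C (α + β + 2) * (X * derivative (shiftedJacobi α β n)) := by ring
  have h := shiftedJacobiCoeff_succ (β := β) hα n k
  rw [e, ← C_neg, coeff_C_mul]
  rcases k with _ | _ | k <;>
  · simp only [coeff_add, coeff_sub, coeff_C_mul, coeff_X_mul, coeff_X_mul_zero, coeff_derivative,
      coeff_shiftedJacobi, zero_add] at h ⊢
    push_cast at h ⊢
    linarith

theorem isOrthogonalSequence_shiftedJacobi (hα : -1 < α) (hβ : 0 < β) :
    IsOrthogonalSequence α β (shiftedJacobi α β) where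
  natDegree_le := natDegree_shiftedJacobi_le
  sign n k hk := by
    rw [eval_zero_iterate_derivative, coeff_shiftedJacobi, mul_left_comm]
    have := shiftedJacobiCoeff_sign hα hβ hk
    positivity
  orthogonal n q hq := betaInt_mul_eq_zero hα (by linarith) (by linarith)
    (shiftedJacobi_ode hα n) hq
  log_derivative n := by
    have h1 : ∀ m : ℕ, (α + 1) * (derivative (shiftedJacobi α β m)).eval 0 =
        -(m * (m + α + β + 1)) * (shiftedJacobi α β m).eval 0 := by
      intro m
      have := congrArg (eval 0) (shiftedJacobi_ode (β := β) hα m)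
      simpa using this
    have h2 : ∀ m : ℕ, 0 < (shiftedJacobi α β m).eval 0 := by
      intro m
      rw [← coeff_zero_eq_eval_zero, coeff_shiftedJacobi]
      simpa using shiftedJacobiCoeff_sign hα hβ (Nat.zero_le m)
    have h3 := h1 n
    have h4 := h1 (n + 1)
    push_cast at h4
    have hn : (0 : ℝ) ≤ n := Nat.cast_nonneg n
    have key : (α + 1) * ((derivative (shiftedJacobi α β n)).eval 0 *
        (shiftedJacobi α β (n + 1)).eval 0 -
        (derivative (shiftedJacobi α β (n + 1))).eval 0 * (shiftedJacobi α β n).eval 0) =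
        (2 * n + α + β + 2) *
        ((shiftedJacobi α β n).eval 0 * (shiftedJacobi α β (n + 1)).eval 0) := by
      linear_combination (shiftedJacobi α β (n + 1)).eval 0 * h3 -
        (shiftedJacobi α β n).eval 0 * h4
    refine pos_right_of_mul_pos (a := α + 1) (by linarith) ?_
    rw [key]
    exact mul_pos (by linarith) (mul_pos (h2 _) (h2 _))

theorem jacobiP_eq_comp (n : ℕ) (α β : ℝ) :
    jacobiP n α β = (shiftedJacobi α β n).comp (C (1 / 2) * (1 - X)) := by
  rw [jacobiP, shiftedJacobi, ← coe_compRingHom_apply, map_sum, Finset.mul_sum]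
  refine Finset.sum_congr rfl fun k _ => ?_
  rw [coe_compRingHom_apply, mul_comp, C_comp, X_pow_comp, shiftedJacobiCoeff, C_mul, mul_assoc]

theorem iterate_derivative_comp_half (p : ℝ[X]) (k : ℕ) :
    derivative^[k] (p.comp (C (1 / 2) * (1 - X))) =
      C ((-(1 / 2)) ^ k) * (derivative^[k] p).comp (C (1 / 2) * (1 - X)) := by
  induction k with
  | zero => simp
  | succ k ih =>
    rw [Function.iterate_succ_apply', ih, Function.iterate_succ_apply', derivative_C_mul,
      derivative_comp, derivative_C_mul, derivative_sub, derivative_one, derivative_X, zero_sub,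
      pow_succ, C_mul, C_neg]
    ring

theorem eval_one_iterate_derivative_jacobiP (n k : ℕ) :
    (derivative^[k] (jacobiP n α β)).eval 1 =
      (-(1 / 2)) ^ k * (k.factorial * shiftedJacobiCoeff α β n k) := by
  rw [jacobiP_eq_comp, iterate_derivative_comp_half, eval_mul, eval_C, eval_comp]
  simp only [eval_mul, eval_C, eval_sub, eval_one, eval_X, sub_self, mul_zero]
  rw [eval_zero_iterate_derivative, coeff_shiftedJacobi]

theorem coeff_jacobiPhi (n k : ℕ) :
    (jacobiPhi n α β).coeff k =
      (1 / 4) ^ k * ((2 * k).factorial * shiftedJacobiCoeff α β n (2 * k)) := by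
  simp only [jacobiPhi, finsetSum_coeff, coeff_C_mul_X_pow, Finset.sum_ite_eq,
    Finset.mem_range, eval_one_iterate_derivative_jacobiP]
  split_ifs with h
  · rw [pow_mul]; norm_num
  · rw [shiftedJacobiCoeff, ascPochhammer_eval_neg_coe_nat_of_lt (by omega)]
    simp

theorem coeff_evenPart_comp {N : ℕ} {p : ℝ[X]} (hp : p.natDegree ≤ N) (c : ℝ) (k : ℕ) :
    ((evenPart N p).comp (C (-c) * X)).coeff k = c ^ k * ((2 * k).factorial * p.coeff (2 * k)) := by
  rw [comp_C_mul_X_coeff, coeff_evenPart]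
  split_ifs with h
  · rw [eval_zero_iterate_derivative, neg_pow c]
    have : (-1 : ℝ) ^ k * (-1) ^ k = 1 := by rw [← mul_pow]; norm_num
    linear_combination (c ^ k * ((2 * k).factorial * p.coeff (2 * k))) * this
  · rw [coeff_eq_zero_of_natDegree_lt (n := 2 * k) (by omega)]
    simp

theorem jacobiPhi_eq (n : ℕ) (α β : ℝ) :
    jacobiPhi n α β = C 1 * (evenPart n (shiftedJacobi α β n)).comp (C (-(1 / 4)) * X) := by
  ext k
  rw [C_1, one_mul, coeff_jacobiPhi, coeff_evenPart_comp (natDegree_shiftedJacobi_le n),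
    coeff_shiftedJacobi]

/-- Differentiation maps Jacobi polynomials to multiples of Jacobi polynomials with parameters
raised by one. -/
theorem shiftedJacobiCoeff_add_one (hα : -1 < α) (hβ : 0 < β) (n : ℕ) :
    ∃ c : ℝ, c ≠ 0 ∧ ∀ k, shiftedJacobiCoeff (α + 1) (β + 1) n k =
      -(c * ((k + 1) * shiftedJacobiCoeff α β (n + 1) (k + 1))) := by
  have h1 : shiftedJacobiCoeff α β (n + 1) 1 ≠ 0 := by
    have := shiftedJacobiCoeff_sign hα hβ (n := n + 1) (k := 1) (by omega)
    exact right_ne_zero_of_mul this.ne'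
  have h2 : shiftedJacobiCoeff (α + 1) (β + 1) n 0 ≠ 0 := by
    have := shiftedJacobiCoeff_sign (α := α + 1) (β := β + 1) (by linarith) (by linarith)
      (Nat.zero_le n)
    exact right_ne_zero_of_mul this.ne'
  refine ⟨-(shiftedJacobiCoeff (α + 1) (β + 1) n 0 / shiftedJacobiCoeff α β (n + 1) 1),
    neg_ne_zero.2 (div_ne_zero h2 h1), fun k => ?_⟩
  -- Both sides satisfy the same two-term recurrence in `k`.
  induction k with
  | zero => field_simp; simp
  | succ k ih =>
    have e1 := shiftedJacobiCoeff_succ (α := α + 1) (β := β + 1) (by linarith) n k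
    have e2 := shiftedJacobiCoeff_succ (β := β) hα (n + 1) (k + 1)
    rw [ih] at e1
    have hk : (0 : ℝ) ≤ k := Nat.cast_nonneg k
    have h3 : ((k : ℝ) + 1) * (k + 1 + (α + 1)) ≠ 0 :=
      (mul_pos (by linarith) (by linarith)).ne'
    refine mul_left_cancel₀ h3 ?_
    rw [e1]
    push_cast at e2 ⊢
    linear_combination ((k : ℝ) + 1) * (-(shiftedJacobiCoeff (α + 1) (β + 1) n 0 /
      shiftedJacobiCoeff α β (n + 1) 1)) * e2

theorem jacobiPhi_add_one_eq (hα : -1 < α) (hβ : 0 < β) (n : ℕ) :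
    ∃ c : ℝ, c ≠ 0 ∧ jacobiPhi n (α + 1) (β + 1) =
      C c * (-evenPart (n + 1) (derivative (shiftedJacobi α β (n + 1)))).comp
        (C (-(1 / 4)) * X) := by
  obtain ⟨c, hc, h⟩ := shiftedJacobiCoeff_add_one hα hβ n
  refine ⟨c, hc, ?_⟩
  ext k
  rw [coeff_C_mul, neg_comp, coeff_neg, coeff_jacobiPhi, coeff_evenPart_comp
    ((natDegree_derivative_le _).trans ((Nat.sub_le _ _).trans (natDegree_shiftedJacobi_le _))),
    coeff_derivative, coeff_shiftedJacobi, h]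
  push_cast
  ring

end

theorem interlace_jacobiPhi {α β : ℝ} (hα : -1 < α) (hα0 : α < 0) (hβ : 0 < β) (n : ℕ) :
    Interlace (jacobiPhi (n + 2) α β) (jacobiPhi n α β) := by
  have h := (isOrthogonalSequence_shiftedJacobi hα hβ).rotatingPair hα hα0 hβ
  rw [jacobiPhi_eq, jacobiPhi_eq]
  exact h.interlace_even n (by norm_num) one_ne_zero one_ne_zero

theorem interlace_jacobiPhi_add_one {α β : ℝ} (hα : -1 < α) (hα0 : α < 0) (hβ : 0 < β) (n : ℕ) :
    Interlace (jacobiPhi (n + 2) (α + 1) (β + 1)) (jacobiPhi n (α + 1) (β + 1)) := by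
  have h := (isOrthogonalSequence_shiftedJacobi hα hβ).rotatingPair hα hα0 hβ
  obtain ⟨c, hc, e⟩ := jacobiPhi_add_one_eq hα hβ (n + 2)
  obtain ⟨c', hc', e'⟩ := jacobiPhi_add_one_eq hα hβ n
  rw [e, e']
  exact h.interlace_odd n (by norm_num) hc hc'

theorem theorem10 (n : ℕ) (hn : 5 ≤ n) :
    (∀ α β : ℝ, -1 < α → α < 0 → 0 < β →
      Interlace (jacobiPhi n (α + 1) (β + 1)) (jacobiPhi (n - 2) (α + 1) (β + 1)) ∧
      Interlace (jacobiPhi n α β) (jacobiPhi (n - 2) α β)) ∧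
    (∀ α β : ℝ, ((-1 < α ∧ α < 0 ∧ 0 < β) ∨ (0 < α ∧ α < 1 ∧ 1 < β)) →
      Interlace (jacobiPhi n α β) (jacobiPhi (n - 2) α β)) := by
  obtain ⟨m, rfl⟩ : ∃ m, n = m + 2 := ⟨n - 2, by omega⟩
  rw [Nat.add_sub_cancel]
  refine ⟨fun α β h1 h2 h3 => ⟨interlace_jacobiPhi_add_one h1 h2 h3 m,
    interlace_jacobiPhi h1 h2 h3 m⟩, fun α β h => ?_⟩
  rcases h with ⟨h1, h2, h3⟩ | ⟨h1, h2, h3⟩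
  · exact interlace_jacobiPhi h1 h2 h3 m
  · have := interlace_jacobiPhi_add_one (α := α - 1) (β := β - 1) (by linarith) (by linarith)
      (by linarith) m
    rwa [sub_add_cancel, sub_add_cancel] at this
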